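/- Let $u_1\ge u_2\ge u_3\ge\dots$ be a non-increasing sequence of numbers in $[0,1]$ with $\sum_{n} u_n=\infty$ and $\lim_{n\to\infty}u_n=0$, and let $U_1,U_2,\dots$ be independent $0$-$1$ valued random variables on a probability space $(\Omega,P)$ with $P(U_n=1)=u_n=1-P(U_n=0)$ for $n\ge 1$. Let $u_0$ be an arbitrary real number, and let $\sum_{n<N}$ denote $\sum_{0\le n<N}$ (the choice of $u_0$ is immaterial; $u_0=0$ gives sums over $1\le n<N$). Then, for $P$-almost every $\omega\in\Omega$, the following holds for every probability space $(X,\Sigma,\mu)$, every measurable, measure preserving transformation $T:X\to X$, and all bounded measurable (real or complex valued) functions $F_1,F_2$ on $X$: $$\lim_{N\to\infty}\frac{1}{\sum_{n<N}u_n}\sum_{n<N}u_n\,F_1\bigl(T^{U_1(\omega)+U_2(\omega)+\dots+U_n(\omega)}x\bigr)\,F_2(T^nx)=\overline F_1(x)\,\overline F_2(x)\qquad\text{for $\mu$-a.e. }x\in X,$$ where $\overline F_i$ is the orthogonal projection of $F_i$ in $L^2(\mu)$ to the closed subspace of $T$-invariant functions $\{f\in L^2(\mu): f\circ T=f\ \mu\text{-a.e.}\}$.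 (The exceptional $P$-null set of $\omega$ does not depend on the system or on the functions; the exceptional $\mu$-null set of $x$ may depend on $\omega$, the system and $F_1,F_2$.) -/

import Mathlib

open MeasureTheory ProbabilityTheory Filter Topology

/-- `U 1, U 2, …` are independent `0`-`1` valued random variables on the probability space
`(Ω, P)` with `P (U n = 1) = u n`.  Only indices `n ≥ 1` are constrained. -/
structure IsRandomSelection {Ω : Type*} [MeasurableSpace Ω] (P : Measure Ω)
    (u : ℕ → ℝ) (U : ℕ → Ω → ℕ) : Prop where
  measurable : ∀ n, 1 ≤ n → Measurable (U n)
  zero_or_one : ∀ n, 1 ≤ n → ∀ ω, U n ω = 0 ∨ U n ω = 1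
  indep : iIndepFun (fun n : {n : ℕ // 1 ≤ n} => U n) P
  prob_one : ∀ n, 1 ≤ n → P.real {ω | U n ω = 1} = u n

section Invariant

variable {X : Type*} [MeasurableSpace X] {μ : Measure X} {T : X → X}

/-- The isometry `f ↦ f ∘ T` of `L²(μ)` induced by a measure preserving map `T`. -/
noncomputable def koopman (𝕜 : Type*) [RCLike 𝕜] (hT : MeasurePreserving T μ μ) :
    Lp 𝕜 2 μ →L[𝕜] Lp 𝕜 2 μ :=
  (Lp.compMeasurePreservingₗᵢ 𝕜 T hT).toContinuousLinearMap

/-- The closed subspace of `T`-invariant functions in `L²(μ)`. -/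
noncomputable def invariantL2 (𝕜 : Type*) [RCLike 𝕜] (hT : MeasurePreserving T μ μ) :
    Submodule 𝕜 (Lp 𝕜 2 μ) :=
  LinearMap.ker ((koopman 𝕜 hT - ContinuousLinearMap.id 𝕜 (Lp 𝕜 2 μ)).toLinearMap)

instance invariantL2_complete (𝕜 : Type*) [RCLike 𝕜] (hT : MeasurePreserving T μ μ) :
    CompleteSpace (invariantL2 𝕜 hT) :=
  (koopman 𝕜 hT - ContinuousLinearMap.id 𝕜 (Lp 𝕜 2 μ)).isClosed_ker.completeSpace_coe

/-- The orthogonal projection in `L²(μ)` of a square integrable function `F` to the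
`T`-invariant functions (a representative of the class). -/
noncomputable def invariantProj {𝕜 : Type*} [RCLike 𝕜] (hT : MeasurePreserving T μ μ)
    {F : X → 𝕜} (hF : MemLp F 2 μ) : X → 𝕜 :=
  ((invariantL2 𝕜 hT).starProjection (hF.toLp F) : Lp 𝕜 2 μ)

/-- A bounded measurable function on a probability space is square integrable. -/
theorem memLp_two_of_bounded {𝕜 : Type*} [RCLike 𝕜] [IsProbabilityMeasure μ] {F : X → 𝕜}
    (hF : Measurable F) (hb : ∃ C : ℝ, ∀ x, ‖F x‖ ≤ C) : MemLp F 2 μ := by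
  obtain ⟨C, hC⟩ := hb
  exact MemLp.of_bound hF.aestronglyMeasurable C (Eventually.of_forall hC)

end Invariant

/-! Put `v n = u (n + 1)`, `e n = U (n + 1) ω`, `s n = e 0 + ... + e (n - 1)` and `W N = ∑ n < N, v
n`. Using `u (n + 1)` instead of `u n` as weight changes the averages negligibly, and makes the
exponent `s n` independent of `e n`, whose mean is `v n`.

The clock `s` is slow: it moves only when `e n = 1`, and `∑ v n * e n = o(W)` because `v → 0` while
`∑ e n ~ W`. So the weights `v n • F₁ (T^[s n] x)` have total variation `o(W)`. Up to a small error,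
`F₂` minus its projection is a coboundary, which such weights annihilate by summation by parts
(`ae_tendsto_weighted_sub_invariantProj`). This replaces `F₂ (T^[n] x)` by the projection of `F₂`
and leaves a single average of `F₁` along `s`.

With weights `e n` in place of `v n`, that average is a Birkhoff average of `F₁` (`sum_selected`).
It remains to see that `∑ (e n - v n) • F₁ (T^[s n] x)` is `o(W)` almost everywhere. Its second
moment is a quadratic form whose coefficients depend only on `s n - s m`, hence it is at most `B ^
2` times `lagEnergy`, a quantity that does not involve the system; therefore one null set of `ω`
serves all systems. Martingale orthogonality bounds the expected energy by `O(W ^ (3/2))`, so energy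
over `W ^ 2` is summable along times with `W ≈ (i + 1) ^ 4`. Since consecutive values of `W` along
these times have ratio tending to `1`, monotonicity fills the gaps. -/

/-! ### Summation by parts, subsequences and quadratic forms in lags. -/

section Deterministic

theorem sum_antitone_mul_le {v a : ℕ → ℝ} (hv : Antitone v) (hv0 : ∀ n, 0 ≤ v n) {l : ℝ}
    (ha : ∀ N : ℕ, ∑ n ∈ Finset.range N, a n ≤ l * N) (N : ℕ) :
    ∑ n ∈ Finset.range N, v n * a n ≤ l * ∑ n ∈ Finset.range N, v n := by
  -- Abel summation as an induction: the partial sums of `a - l` are nonpositive, so lowering the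
  -- factor from `v N` to `v (N + 1)` only raises the right side.
  have key : ∀ N : ℕ, ∑ n ∈ Finset.range N, v n * (a n - l) ≤
      v N * ∑ n ∈ Finset.range N, (a n - l) := by
    intro N
    induction N with
    | zero => simp
    | succ N ih =>
      have h1 : ∑ n ∈ Finset.range (N + 1), (a n - l) ≤ 0 := by
        have := ha (N + 1)
        simp only [Finset.sum_sub_distrib, Finset.sum_const, Finset.card_range, nsmul_eq_mul]
        linarith
      calc _ ≤ v N * ∑ n ∈ Finset.range (N + 1), (a n - l) := by
            rw [Finset.sum_range_succ, Finset.sum_range_succ, mul_add]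
            gcongr
        _ ≤ _ := mul_le_mul_of_nonpos_right (hv N.le_succ) h1
  have h2 : ∑ n ∈ Finset.range N, (a n - l) ≤ 0 := by
    have := ha N
    simp only [Finset.sum_sub_distrib, Finset.sum_const, Finset.card_range, nsmul_eq_mul]
    linarith
  have h3 := (key N).trans (mul_nonpos_of_nonneg_of_nonpos (hv0 N) h2)
  simp only [mul_sub, Finset.sum_sub_distrib, ← Finset.sum_mul] at h3
  linarith

theorem norm_sum_mul_sub_succ_le {𝕜 : Type*} [RCLike 𝕜] {w b : ℕ → 𝕜} {B : ℝ}
    (hb : ∀ n, ‖b n‖ ≤ B) (N : ℕ) :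
    ‖∑ n ∈ Finset.range N, w n * (b n - b (n + 1))‖ ≤
      2 * B * (‖w 0‖ + ∑ n ∈ Finset.range N, ‖w (n + 1) - w n‖) := by
  have hB : 0 ≤ B := (norm_nonneg _).trans (hb 0)
  have h1 : ∑ n ∈ Finset.range N, w n * (b n - b (n + 1)) =
      w 0 * b 0 - w N * b N + ∑ n ∈ Finset.range N, (w (n + 1) - w n) * b (n + 1) := by
    induction N with
    | zero => simp
    | succ N ih => rw [Finset.sum_range_succ, Finset.sum_range_succ, ih]; ring
  have h2 : ‖w N‖ ≤ ‖w 0‖ + ∑ n ∈ Finset.range N, ‖w (n + 1) - w n‖ := by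
    calc ‖w N‖ = ‖w 0 + ∑ n ∈ Finset.range N, (w (n + 1) - w n)‖ := by
          rw [Finset.sum_range_sub]; simp
      _ ≤ _ := (norm_add_le _ _).trans (by gcongr; exact norm_sum_le _ _)
  have h3 : ‖∑ n ∈ Finset.range N, (w (n + 1) - w n) * b (n + 1)‖ ≤
      (∑ n ∈ Finset.range N, ‖w (n + 1) - w n‖) * B := by
    rw [Finset.sum_mul]
    refine norm_sum_le_of_le _ fun n _ => ?_
    rw [norm_mul]
    gcongr
    exact hb _
  have h4 : ‖w 0 * b 0‖ ≤ ‖w 0‖ * B := by rw [norm_mul]; gcongr; exact hb _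
  have h5 : ‖w N * b N‖ ≤ (‖w 0‖ + ∑ n ∈ Finset.range N, ‖w (n + 1) - w n‖) * B := by
    rw [norm_mul]; gcongr; exact hb _
  rw [h1]
  calc _ ≤ ‖w 0 * b 0‖ + ‖w N * b N‖ + _ := (norm_add_le _ _).trans
        (add_le_add_left (norm_sub_le _ _) _)
    _ ≤ _ := by linarith

/-- Gap filling: convergence along a subsequence on which the normalisation grows slowly. -/
theorem tendsto_inv_smul_of_subseq {E : Type*} [NormedAddCommGroup E] [NormedSpace ℝ E]
    {D : ℕ → E} {H W : ℕ → ℝ} {r : ℕ → ℕ} {h : ℝ}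
    (hD : ∀ M N, M ≤ N → ‖D N - D M‖ ≤ H N - H M) (hW : Monotone W)
    (hr : Monotone r) (hr' : Tendsto r atTop atTop)
    (hpos : ∀ i, 0 < W (r i))
    (hratio : Tendsto (fun i => W (r (i + 1)) / W (r i)) atTop (𝓝 1))
    (hDr : Tendsto (fun i => (W (r i))⁻¹ • D (r i)) atTop (𝓝 0))
    (hHr : Tendsto (fun i => H (r i) / W (r i)) atTop (𝓝 h)) :
    Tendsto (fun N => (W N)⁻¹ • D N) atTop (𝓝 0) := by
  have hH : Monotone H := fun M N hMN => by
    have := (norm_nonneg _).trans (hD M N hMN); linarith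
  -- The bracket bounds the oscillation of `D` between `r i` and `r (i + 1)`, relative to `W (r i)`;
  -- it tends to `h * 1 - h = 0`.
  have h1 : Tendsto (fun i => ‖(W (r i))⁻¹ • D (r i)‖ +
      (H (r (i + 1)) / W (r (i + 1)) * (W (r (i + 1)) / W (r i)) - H (r i) / W (r i)))
      atTop (𝓝 0) := by
    have := hDr.norm.add
      (((hHr.comp (tendsto_add_atTop_nat 1)).mul hratio).sub hHr)
    simpa using this
  rw [Metric.tendsto_atTop]
  intro ε hε
  obtain ⟨i₀, hi₀⟩ := (Metric.tendsto_atTop.1 h1) ε hε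
  refine ⟨r i₀, fun N hN => ?_⟩
  have hex : ∃ k, N < r k := (hr'.eventually_gt_atTop N).exists
  classical
  have hf : N < r (Nat.find hex) := Nat.find_spec hex
  have hlt : i₀ < Nat.find hex := by
    by_contra hcon
    have := hr (not_lt.1 hcon)
    omega
  obtain ⟨i, hi⟩ : ∃ i, Nat.find hex = i + 1 := ⟨Nat.find hex - 1, by omega⟩
  have hi1 : r i ≤ N := not_lt.1 (Nat.find_min hex (m := i) (by omega))
  rw [hi] at hf
  have hb := hi₀ i (by omega)
  rw [Real.dist_eq, sub_zero] at hb
  have hWi := hpos i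
  have hWi1 := hpos (i + 1)
  have hWN : W (r i) ≤ W N := hW hi1
  rw [dist_zero_right]
  refine lt_of_le_of_lt ?_ (lt_of_abs_lt hb)
  have e1 : H (r (i + 1)) / W (r (i + 1)) * (W (r (i + 1)) / W (r i)) - H (r i) / W (r i)
      = (W (r i))⁻¹ * (H (r (i + 1)) - H (r i)) := by
    field_simp
  rw [e1, norm_smul, norm_smul, norm_inv, norm_inv, Real.norm_of_nonneg hWi.le,
    Real.norm_of_nonneg (hWi.le.trans hWN), ← mul_add]
  have e2 : ‖D N‖ ≤ ‖D (r i)‖ + (H (r (i + 1)) - H (r i)) := by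
    have a1 := hD _ _ hi1
    have a2 := hH hf.le
    have a3 := norm_le_norm_add_norm_sub' (D N) (D (r i))
    linarith
  gcongr

/-- A subsequence along which partial sums of a sequence in `[0,1]` grow like `(i + 1) ^ 4`. -/
theorem exists_subseq_quartic {v : ℕ → ℝ} (hv1 : ∀ n, v n ≤ 1)
    (hsum : Tendsto (fun N : ℕ => ∑ n ∈ Finset.range N, v n) atTop atTop) :
    ∃ r : ℕ → ℕ, Monotone r ∧ Tendsto r atTop atTop ∧
      ∀ i : ℕ, ((i : ℝ) + 1) ^ 4 ≤ ∑ n ∈ Finset.range (r i), v n ∧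
        ∑ n ∈ Finset.range (r i), v n ≤ ((i : ℝ) + 1) ^ 4 + 1 := by
  classical
  have hex : ∀ i : ℕ, ∃ N : ℕ, ((i : ℝ) + 1) ^ 4 ≤ ∑ n ∈ Finset.range N, v n := fun i =>
    (hsum.eventually_ge_atTop _).exists
  have hle : ∀ N : ℕ, ∑ n ∈ Finset.range N, v n ≤ N := fun N => by
    calc _ ≤ ∑ n ∈ Finset.range N, (1 : ℝ) := Finset.sum_le_sum fun n _ => hv1 n
      _ = N := by simp
  refine ⟨fun i => Nat.find (hex i), ?_, ?_, fun i => ⟨Nat.find_spec (hex i), ?_⟩⟩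
  · intro i j hij
    refine Nat.find_min' _ (le_trans ?_ (Nat.find_spec (hex j)))
    gcongr
  · refine tendsto_atTop_mono (fun i => ?_) tendsto_id
    have h1 := (Nat.find_spec (hex i)).trans (hle _)
    have h2 : (i : ℝ) ≤ ((i : ℝ) + 1) ^ 4 := by
      have : (1 : ℝ) ≤ (i : ℝ) + 1 := by linarith [Nat.cast_nonneg (α := ℝ) i]
      calc (i : ℝ) ≤ (i + 1) ^ 1 := by linarith
        _ ≤ _ := pow_le_pow_right₀ this (by norm_num)
    exact_mod_cast h2.trans h1
  · have hpos : 0 < Nat.find (hex i) := by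
      rw [Nat.find_pos]
      simp only [Finset.range_zero, Finset.sum_empty, not_le]
      positivity
    obtain ⟨N, hN⟩ : ∃ N, Nat.find (hex i) = N + 1 := ⟨Nat.find (hex i) - 1, by omega⟩
    -- By minimality the sum was still below the target one step earlier, and one step adds at most
    -- `1`.
    have h1 := not_le.1 (Nat.find_min (hex i) (m := N) (by omega))
    beta_reduce
    rw [hN, Finset.sum_range_succ]
    linarith [hv1 N]

/-- The sum of `y m` over `m < n` with `s n - s m = j`. -/
def lagPart (s : ℕ → ℕ) (y : ℕ → ℝ) (n j : ℕ) : ℝ :=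
  ∑ m ∈ Finset.range n, if s m + j = s n then y m else 0

/-- The correlation sum of `y` over pairs `m < n < N` with `s n - s m = j`. -/
def lagSum (s : ℕ → ℕ) (y : ℕ → ℝ) (N j : ℕ) : ℝ :=
  ∑ n ∈ Finset.range N, y n * lagPart s y n j

/-- Controls all quadratic forms in `y` with coefficients depending on `s n - s m`. -/
def lagEnergy (s : ℕ → ℕ) (y : ℕ → ℝ) (N : ℕ) : ℝ :=
  ∑ n ∈ Finset.range N, y n ^ 2 + 2 * ∑ j ∈ Finset.range N, |lagSum s y N j|

theorem sum_mul_coeff_eq_lagPart {s : ℕ → ℕ} (hs : Monotone s) (hs' : ∀ n, s n ≤ n) (y : ℕ → ℝ)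
    (c : ℕ → ℝ) {n N : ℕ} (hn : n < N) :
    ∑ m ∈ Finset.range n, y m * c (s n - s m) =
      ∑ j ∈ Finset.range N, c j * lagPart s y n j := by
  simp only [lagPart, Finset.mul_sum]
  rw [Finset.sum_comm]
  refine Finset.sum_congr rfl fun m hm => ?_
  have h1 := hs (Finset.mem_range.1 hm).le
  have h2 := hs' n
  rw [Finset.sum_eq_single (s n - s m)]
  · rw [if_pos (by omega), mul_comm]
  · intro j _ hj
    rw [if_neg (by omega), mul_zero]
  · intro h
    exact absurd (Finset.mem_range.2 (by omega)) h

/-- Grouping pairs by lag makes the form linear in `c`, with the lag sums as coefficients. The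
coefficients `c` will be correlations of a dynamical system; only their supremum survives. -/
theorem quadratic_le_lagEnergy {s : ℕ → ℕ} (hs : Monotone s) (hs' : ∀ n, s n ≤ n) (y : ℕ → ℝ)
    {c : ℕ → ℝ} {B : ℝ} (hc : ∀ j, |c j| ≤ B) (N : ℕ) :
    ∑ n ∈ Finset.range N, y n ^ 2 * c 0 +
      2 * ∑ n ∈ Finset.range N, ∑ m ∈ Finset.range n, y n * y m * c (s n - s m) ≤
      B * lagEnergy s y N := by
  have h1 : ∑ n ∈ Finset.range N, ∑ m ∈ Finset.range n, y n * y m * c (s n - s m) =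
      ∑ j ∈ Finset.range N, c j * lagSum s y N j := by
    simp only [lagSum, Finset.mul_sum]
    rw [Finset.sum_comm]
    refine Finset.sum_congr rfl fun n hn => ?_
    simp only [mul_assoc, ← Finset.mul_sum,
      sum_mul_coeff_eq_lagPart hs hs' y c (Finset.mem_range.1 hn)]
    rw [Finset.mul_sum]
    exact Finset.sum_congr rfl fun j _ => by ring
  have h2 : ∑ j ∈ Finset.range N, c j * lagSum s y N j ≤
      B * ∑ j ∈ Finset.range N, |lagSum s y N j| := by
    rw [Finset.mul_sum]
    refine Finset.sum_le_sum fun j _ => (le_abs_self _).trans ?_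
    rw [abs_mul]
    gcongr
    exact hc j
  have h3 : ∑ n ∈ Finset.range N, y n ^ 2 * c 0 ≤ B * ∑ n ∈ Finset.range N, y n ^ 2 := by
    rw [Finset.mul_sum]
    refine Finset.sum_le_sum fun n _ => ?_
    rw [mul_comm]
    gcongr
    exact (le_abs_self _).trans (hc 0)
  rw [h1, lagEnergy]
  linarith

theorem norm_sum_smul_sq {𝕜 : Type*} [RCLike 𝕜] (y : ℕ → ℝ) (a : ℕ → 𝕜) (N : ℕ) :
    ‖∑ n ∈ Finset.range N, y n • a n‖ ^ 2 = ∑ n ∈ Finset.range N, y n ^ 2 * ‖a n‖ ^ 2 +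
      2 * ∑ n ∈ Finset.range N, ∑ m ∈ Finset.range n,
        y n * y m * RCLike.re (inner 𝕜 (a m) (a n)) := by
  induction N with
  | zero => simp
  | succ N ih =>
    rw [Finset.sum_range_succ, norm_add_sq (𝕜 := 𝕜), ih, Finset.sum_range_succ,
      Finset.sum_range_succ _ N, norm_smul, sum_inner, map_sum, mul_pow, Real.norm_eq_abs, sq_abs]
    have : ∀ m, RCLike.re (inner 𝕜 (y m • a m) (y N • a N)) =
        y N * y m * RCLike.re (inner 𝕜 (a m) (a N)) := fun m => by
      rw [RCLike.real_smul_eq_coe_mul, RCLike.real_smul_eq_coe_mul, ← smul_eq_mul, ← smul_eq_mul,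
        inner_smul_left, inner_smul_right, RCLike.conj_ofReal, RCLike.re_ofReal_mul,
        RCLike.re_ofReal_mul]
      ring
    simp only [this]
    ring

end Deterministic

/-! ### Maximal inequality, invariant projection and mean ergodic theorem. -/

section Ergodic

variable {X : Type*} [MeasurableSpace X] {μ : Measure X} {T : X → X}

/-- Hopf's maximal ergodic inequality for finitely many times. -/
theorem setIntegral_partialSups_birkhoffSum_nonneg (hT : MeasurePreserving T μ μ) {f : X → ℝ}
    (hfm : Measurable f) (hf : Integrable f μ) (n : ℕ) :
    0 ≤ ∫ x in {x | 0 < partialSups (fun k => birkhoffSum T f k x) n}, f x ∂μ := by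
  have hint : ∀ k, Integrable (birkhoffSum T f k) μ := fun k =>
    integrable_finsetSum _ fun i _ => (hT.iterate i).integrable_comp_of_integrable hf
  have hmeas : ∀ k, Measurable (birkhoffSum T f k) := fun k =>
    Finset.measurable_sum _ fun i _ => hfm.comp (hT.measurable.iterate i)
  set M : X → ℝ := fun x => partialSups (fun k => birkhoffSum T f k x) n with hM
  have hMm : Measurable M ∧ Integrable M μ := by
    clear_value M
    subst hM
    induction n with
    | zero => simp
    | succ n ih =>
      simp only [partialSups_add_one]
      exact ⟨ih.1.sup (hmeas _), ih.2.sup (hint _)⟩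
  have hM0 : ∀ x, 0 ≤ M x := fun x => by
    have := le_partialSups_of_le (fun k => birkhoffSum T f k x) (Nat.zero_le n)
    simpa using this
  have hE : MeasurableSet {x | 0 < M x} := measurableSet_lt measurable_const hMm.1
  have hMT : Integrable (fun x => M (T x)) μ := hT.integrable_comp_of_integrable hMm.2
  -- Garsia's argument: a positive maximum is attained at some `k + 1`, and removing the first term
  -- of that sum leaves a sum of length `k` started at `T x`.
  have key : ∀ x, 0 < M x → M x - M (T x) ≤ f x := by
    intro x hx
    obtain ⟨k, hk, hk'⟩ : ∃ k ≤ n, M x = birkhoffSum T f k x :=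
      exists_partialSups_eq (fun k => birkhoffSum T f k x) n
    cases k with
    | zero => simp [hk'] at hx
    | succ k =>
      have h1 : birkhoffSum T f k (T x) ≤ M (T x) :=
        le_partialSups_of_le (fun k => birkhoffSum T f k (T x)) (by omega : k ≤ n)
      rw [hk', birkhoffSum_succ']
      linarith
  calc (0 : ℝ) = ∫ x, (M x - M (T x)) ∂μ := by
        rw [integral_sub hMm.2 hMT]
        have : ∫ x, M (T x) ∂μ = ∫ x, M x ∂μ := by
          conv_rhs => rw [← hT.map_eq]
          rw [integral_map hT.measurable.aemeasurable hMm.1.aestronglyMeasurable]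
        rw [this, sub_self]
    -- Off this set `M x = 0 ≤ M (T x)`, so the discarded part of the integral is nonpositive.
    _ ≤ ∫ x in {x | 0 < M x}, (M x - M (T x)) ∂μ := by
        rw [← integral_indicator hE]
        refine integral_mono (hMm.2.sub hMT) ((hMm.2.sub hMT).indicator hE) fun x => ?_
        by_cases hx : 0 < M x
        · simp [Set.indicator, hx]
        · have h0 : M x = 0 := le_antisymm (not_lt.1 hx) (hM0 x)
          simp [Set.indicator, h0, hM0 (T x)]
    _ ≤ _ := setIntegral_mono_on (hMm.2.sub hMT).integrableOn hf.integrableOn hE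
        fun x hx => key x hx

/-- The weak type `(1,1)` maximal ergodic inequality. -/
theorem measure_exists_lt_birkhoffSum_le [IsProbabilityMeasure μ] (hT : MeasurePreserving T μ μ)
    {f : X → ℝ} (hfm : Measurable f) (hf : Integrable f μ) (hf0 : ∀ x, 0 ≤ f x) {l : ℝ}
    (hl : 0 < l) :
    μ {x | ∃ N : ℕ, l * N < ∑ k ∈ Finset.range N, f (T^[k] x)} ≤
      ENNReal.ofReal ((∫ x, f x ∂μ) / l) := by
  have hS : ∀ N x, birkhoffSum T (fun x => f x - l) N x =
      (∑ k ∈ Finset.range N, f (T^[k] x)) - l * N := fun N x => by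
    simp [birkhoffSum, Finset.sum_sub_distrib, mul_comm]
  have hmeas : ∀ k, Measurable (birkhoffSum T (fun x => f x - l) k) := fun k =>
    Finset.measurable_sum _ fun i _ => (hfm.sub_const l).comp (hT.measurable.iterate i)
  set E : ℕ → Set X := fun n =>
    {x | 0 < partialSups (fun k => birkhoffSum T (fun x => f x - l) k x) n} with hE
  have hEm : ∀ n, MeasurableSet (E n) := fun n => by
    refine measurableSet_lt measurable_const ?_
    induction n with
    | zero => simp
    | succ n ih =>
      simp only [partialSups_add_one]
      exact ih.sup (hmeas _)
  have hmono : Monotone E := fun m n hmn x hx => by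
    simp only [hE, Set.mem_ofPred_eq] at hx ⊢
    exact hx.trans_le ((partialSups (fun k => birkhoffSum T (fun x => f x - l) k x)).monotone hmn)
  have hU : {x | ∃ N : ℕ, l * N < ∑ k ∈ Finset.range N, f (T^[k] x)} = ⋃ n, E n := by
    ext x
    simp only [Set.mem_ofPred_eq, Set.mem_iUnion, hE]
    constructor
    · rintro ⟨N, hN⟩
      refine ⟨N, lt_of_lt_of_le ?_ (le_partialSups _ N)⟩
      rw [hS]
      linarith
    · rintro ⟨n, hn⟩
      obtain ⟨k, -, hk'⟩ :=
        exists_partialSups_eq (fun k => birkhoffSum T (fun x => f x - l) k x) n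
      rw [hk', hS] at hn
      exact ⟨k, by linarith⟩
  rw [hU, hmono.measure_iUnion]
  refine iSup_le fun n => ?_
  rw [← ofReal_measureReal]
  refine ENNReal.ofReal_le_ofReal ?_
  rw [le_div_iff₀ hl]
  have h1 := setIntegral_partialSups_birkhoffSum_nonneg hT (hfm.sub_const l)
    (hf.sub (integrable_const l)) n
  change 0 ≤ ∫ x in E n, (f x - l) ∂μ at h1
  rw [integral_sub hf.integrableOn (integrable_const l).integrableOn, setIntegral_const,
    smul_eq_mul] at h1
  have h2 := setIntegral_le_integral (s := E n) hf (Eventually.of_forall hf0)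
  linarith

variable {𝕜 : Type*} [RCLike 𝕜]

theorem koopman_toLp (hT : MeasurePreserving T μ μ) {f : X → 𝕜} (hf : MemLp f 2 μ) :
    koopman 𝕜 hT (hf.toLp f) = (hf.comp_measurePreserving hT).toLp (f ∘ T) := rfl

theorem koopman_iterate_toLp (hT : MeasurePreserving T μ μ) {f : X → 𝕜} (hf : MemLp f 2 μ)
    (k : ℕ) : (koopman 𝕜 hT)^[k] (hf.toLp f) =
      (hf.comp_measurePreserving (hT.iterate k)).toLp (f ∘ T^[k]) := by
  induction k with
  | zero => rfl
  | succ k ih =>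
    rw [Function.iterate_succ_apply', ih, koopman_toLp]
    rfl

theorem mem_invariantL2_iff (hT : MeasurePreserving T μ μ) {f : Lp 𝕜 2 μ} :
    f ∈ invariantL2 𝕜 hT ↔ koopman 𝕜 hT f = f := by
  simp [invariantL2, sub_eq_zero]

theorem invariantL2_eq_eqLocus (hT : MeasurePreserving T μ μ) :
    invariantL2 𝕜 hT = (koopman 𝕜 hT).eqLocus (1 : Lp 𝕜 2 μ →L[𝕜] Lp 𝕜 2 μ) := by
  ext f
  exact mem_invariantL2_iff hT

theorem invariantProj_stronglyMeasurable (hT : MeasurePreserving T μ μ) {F : X → 𝕜}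
    (hF : MemLp F 2 μ) : StronglyMeasurable (invariantProj hT hF) :=
  Lp.stronglyMeasurable _

theorem invariantProj_memLp (hT : MeasurePreserving T μ μ) {F : X → 𝕜}
    (hF : MemLp F 2 μ) : MemLp (invariantProj hT hF) 2 μ :=
  Lp.memLp _

/-- Preimages of null sets under iterates are null, so the chosen representative is constant along
almost every forward orbit. -/
theorem invariantProj_comp_ae (hT : MeasurePreserving T μ μ) {F : X → 𝕜}
    (hF : MemLp F 2 μ) : ∀ᵐ x ∂μ, ∀ n : ℕ, invariantProj hT hF (T^[n] x) =
      invariantProj hT hF x := by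
  have h1 : invariantProj hT hF ∘ T =ᵐ[μ] invariantProj hT hF := by
    have hmem := (invariantL2 𝕜 hT).starProjection_apply_mem (hF.toLp F)
    have h2 : koopman 𝕜 hT ((invariantL2 𝕜 hT).starProjection (hF.toLp F)) =
        (invariantL2 𝕜 hT).starProjection (hF.toLp F) := by
      exact (mem_invariantL2_iff hT).1 hmem
    have h3 := Lp.coeFn_compMeasurePreserving
      ((invariantL2 𝕜 hT).starProjection (hF.toLp F)) hT
    exact h3.symm.trans (Filter.EventuallyEq.of_eq (congrArg (fun f : Lp 𝕜 2 μ => (f : X → 𝕜)) h2))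
  have h2 : ∀ᵐ x ∂μ, ∀ n : ℕ,
      (invariantProj hT hF ∘ T) (T^[n] x) = invariantProj hT hF (T^[n] x) :=
    ae_all_iff.2 fun n => (hT.iterate n).quasiMeasurePreserving.ae h1
  filter_upwards [h2] with x hx n
  induction n with
  | zero => rfl
  | succ n ih =>
    rw [Function.iterate_succ_apply', ← ih]
    exact hx n

/-- Von Neumann's mean ergodic theorem in `L¹` form. -/
theorem tendsto_integral_birkhoffAverage_sub_invariantProj [IsProbabilityMeasure μ]
    (hT : MeasurePreserving T μ μ) {F : X → 𝕜} (hF : MemLp F 2 μ) :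
    Tendsto (fun N : ℕ => ∫ x, ‖birkhoffAverage 𝕜 T F N x - invariantProj hT hF x‖ ∂μ)
      atTop (𝓝 0) := by
  have h1 := (koopman 𝕜 hT).tendsto_birkhoffAverage_orthogonalProjection
    (LinearIsometry.norm_toContinuousLinearMap_le _) (hF.toLp F)
  have h2 : (((koopman 𝕜 hT).eqLocus (1 : Lp 𝕜 2 μ →L[𝕜] Lp 𝕜 2 μ)).orthogonalProjectionOnto
      (hF.toLp F) : Lp 𝕜 2 μ) = (invariantL2 𝕜 hT).starProjection (hF.toLp F) := by
    simp only [invariantL2_eq_eqLocus]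
    rfl
  rw [h2] at h1
  have h3 := tendsto_iff_norm_sub_tendsto_zero.1 h1
  refine squeeze_zero (fun N => integral_nonneg fun x => norm_nonneg _) (fun N => ?_) h3
  have hae : ((birkhoffAverage 𝕜 (koopman 𝕜 hT) _root_.id N (hF.toLp F) : Lp 𝕜 2 μ) : X → 𝕜) =ᵐ[μ]
      birkhoffAverage 𝕜 T F N := by
    have hm : MemLp (birkhoffAverage 𝕜 T F N) 2 μ := by
      exact (memLp_finsetSum (Finset.range N) fun k _ =>
        hF.comp_measurePreserving (hT.iterate k)).const_smul (N : 𝕜)⁻¹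
    have : birkhoffAverage 𝕜 (koopman 𝕜 hT) _root_.id N (hF.toLp F) = hm.toLp _ := by
      have e1 : ∀ s : Finset ℕ, ∑ k ∈ s, (koopman 𝕜 hT)^[k] (hF.toLp F) =
          (memLp_finsetSum' s fun k _ =>
            hF.comp_measurePreserving (hT.iterate k)).toLp (∑ k ∈ s, F ∘ T^[k]) := fun s => by
        simp only [koopman_iterate_toLp]
        induction s using Finset.cons_induction with
        | empty => rfl
        | cons a s ha ih =>
          simp only [Finset.sum_cons, ih]
          rfl
      rw [birkhoffAverage, birkhoffSum]
      simp only [_root_.id]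
      rw [e1, ← MemLp.toLp_const_smul]
      refine MemLp.toLp_congr _ _ (Eventually.of_forall fun x => ?_)
      simp [birkhoffAverage, birkhoffSum]
    rw [this]
    exact hm.coeFn_toLp
  have hae2 : ((birkhoffAverage 𝕜 (koopman 𝕜 hT) _root_.id N (hF.toLp F) -
      (invariantL2 𝕜 hT).starProjection (hF.toLp F) : Lp 𝕜 2 μ) : X → 𝕜) =ᵐ[μ]
      fun x => birkhoffAverage 𝕜 T F N x - invariantProj hT hF x := by
    filter_upwards [hae, Lp.coeFn_sub (birkhoffAverage 𝕜 (koopman 𝕜 hT) _root_.id N (hF.toLp F))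
      ((invariantL2 𝕜 hT).starProjection (hF.toLp F))] with x hx hx'
    rw [hx', Pi.sub_apply, hx]
    rfl
  set d := birkhoffAverage 𝕜 (koopman 𝕜 hT) _root_.id N (hF.toLp F) -
      (invariantL2 𝕜 hT).starProjection (hF.toLp F)
  have e : ∫ x, ‖birkhoffAverage 𝕜 T F N x - invariantProj hT hF x‖ ∂μ = ∫ x, ‖d x‖ ∂μ :=
    integral_congr_ae (by filter_upwards [hae2] with x hx; rw [hx])
  rw [e, integral_norm_eq_lintegral_enorm (Lp.aestronglyMeasurable d), Lp.norm_def,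
    ← eLpNorm_one_eq_lintegral_enorm]
  exact ENNReal.toReal_mono (Lp.eLpNorm_ne_top d)
    (eLpNorm_le_eLpNorm_of_exponent_le (by norm_num) (Lp.aestronglyMeasurable d))

end Ergodic

/-- A function differs from its ergodic average by an explicit coboundary. -/
theorem sub_birkhoffAverage_eq {X : Type*} {T : X → X} {𝕜 : Type*} [RCLike 𝕜] (F : X → 𝕜)
    {m : ℕ} (hm : m ≠ 0) (x : X) :
    F x - birkhoffAverage 𝕜 T F m x =
      (m : 𝕜)⁻¹ * (∑ k ∈ Finset.range m, birkhoffSum T F k x) -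
      (m : 𝕜)⁻¹ * (∑ k ∈ Finset.range m, birkhoffSum T F k (T x)) := by
  have hm' : (m : 𝕜) ≠ 0 := Nat.cast_ne_zero.2 hm
  have h : ∀ k, F x - F (T^[k] x) = birkhoffSum T F k x - birkhoffSum T F k (T x) := fun k => by
    have h1 := birkhoffSum_succ T F k x
    have h2 := birkhoffSum_succ' T F k x
    rw [h1] at h2
    linear_combination -h2
  rw [← mul_sub, ← Finset.sum_sub_distrib, ← Finset.sum_congr rfl fun k _ => h k,
    Finset.sum_sub_distrib, birkhoffAverage, birkhoffSum]
  simp only [Finset.sum_const, Finset.card_range, nsmul_eq_mul, smul_eq_mul]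
  field_simp

/-! ### Weighted pointwise convergence and second moments. -/

section Ergodic

variable {X : Type*} [MeasurableSpace X] {μ : Measure X} {T : X → X}
variable {𝕜 : Type*} [RCLike 𝕜]

/-- `F` minus its projection is the error of a long ergodic average plus a bounded coboundary. The
maximal inequality makes the first part small along almost every orbit, uniformly in `N`; the second
is absorbed by the small variation of the weights. The null set depends only on `F`, so the weights
may depend on `x` without any measurability. -/
theorem ae_tendsto_weighted_sub_invariantProj [IsProbabilityMeasure μ]
    (hT : MeasurePreserving T μ μ) {F : X → 𝕜} (hFm : Measurable F) {B : ℝ}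
    (hB : ∀ x, ‖F x‖ ≤ B) (hF : MemLp F 2 μ) {v : ℕ → ℝ} (hv : Antitone v)
    (hv0 : ∀ n, 0 ≤ v n) (hsum : Tendsto (fun N : ℕ => ∑ n ∈ Finset.range N, v n) atTop atTop)
    {w : X → ℕ → 𝕜} {C : ℝ} (hC : 0 ≤ C) (hw : ∀ x n, ‖w x n‖ ≤ C * v n)
    (hw' : ∀ x, Tendsto (fun N : ℕ => (∑ n ∈ Finset.range N, ‖w x (n + 1) - w x n‖) /
      ∑ n ∈ Finset.range N, v n) atTop (𝓝 0)) :
    ∀ᵐ x ∂μ, Tendsto (fun N : ℕ => (∑ n ∈ Finset.range N, v n)⁻¹ •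
      ∑ n ∈ Finset.range N, w x n * (F (T^[n] x) - invariantProj hT hF x)) atTop (𝓝 0) := by
  set p := invariantProj hT hF with hp
  have hpm : Measurable p := (invariantProj_stronglyMeasurable hT hF).measurable
  have hp1 : Integrable p μ := (invariantProj_memLp hT hF).integrable (by norm_num)
  let h : ℕ → X → ℝ := fun m x => ‖birkhoffAverage 𝕜 T F m x - p x‖
  have hAm : ∀ m, Measurable (birkhoffAverage 𝕜 T F m) := fun m =>
    (Finset.measurable_sum (Finset.range m) fun k _ =>
      hFm.comp (hT.measurable.iterate k)).const_smul (m : 𝕜)⁻¹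
  have hAi : ∀ m, Integrable (birkhoffAverage 𝕜 T F m) μ := fun m =>
    (integrable_finsetSum (Finset.range m) fun k _ =>
      (hT.iterate k).integrable_comp_of_integrable (hF.integrable (by norm_num))).smul (m : 𝕜)⁻¹
  have hhm : ∀ m, Measurable (h m) := fun m => ((hAm m).sub hpm).norm
  have hhi : ∀ m, Integrable (h m) μ := fun m => ((hAi m).sub hp1).norm
  have hlim := tendsto_integral_birkhoffAverage_sub_invariantProj hT hF
  -- An `L¹` error of `4 ^ (-j)` tested at level `2 ^ (-j)` gives exceptional sets of measure at
  -- most `2 ^ (-j)`, so Borel–Cantelli applies.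
  have hex : ∀ j : ℕ, ∃ m : ℕ, m ≠ 0 ∧ ∫ x, h m x ∂μ ≤ (1 / 4 : ℝ) ^ j := fun j => by
    have h1 : ∀ᶠ m in atTop, ∫ x, h m x ∂μ < (1 / 4 : ℝ) ^ j :=
      hlim.eventually_lt_const (by positivity)
    obtain ⟨m, hm, hm'⟩ := (h1.and (eventually_ne_atTop 0)).exists
    exact ⟨m, hm', hm.le⟩
  choose m hm0 hm using hex
  let E : ℕ → Set X := fun j =>
    {x | ∃ N : ℕ, (1 / 2 : ℝ) ^ j * N < ∑ k ∈ Finset.range N, h (m j) (T^[k] x)}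
  have hE : ∀ j, μ (E j) ≤ ENNReal.ofReal ((1 / 2 : ℝ) ^ j) := fun j => by
    refine (measure_exists_lt_birkhoffSum_le hT (hhm _) (hhi _) (fun x => norm_nonneg _)
      (by positivity)).trans (ENNReal.ofReal_le_ofReal ?_)
    rw [div_le_iff₀ (by positivity), ← mul_pow]
    norm_num
    simpa using hm j
  have hE' : ∑' j, μ (E j) ≠ ⊤ := by
    refine ne_top_of_le_ne_top ?_ (ENNReal.tsum_le_tsum hE)
    rw [← ENNReal.ofReal_tsum_of_nonneg (fun j => by positivity) summable_geometric_two]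
    exact ENNReal.ofReal_ne_top
  filter_upwards [ae_eventually_notMem hE', invariantProj_comp_ae hT hF] with x hx hinv
  rw [Metric.tendsto_atTop']
  intro ε hε
  have hsmall : ∀ᶠ j in atTop, C * (1 / 2 : ℝ) ^ j < ε / 2 := by
    have : Tendsto (fun j : ℕ => C * (1 / 2 : ℝ) ^ j) atTop (𝓝 (C * 0)) :=
      (tendsto_pow_atTop_nhds_zero_of_lt_one (by norm_num) (by norm_num)).const_mul C
    rw [mul_zero] at this
    exact this.eventually_lt_const (by positivity)
  obtain ⟨j, hj, hjx⟩ := (hsmall.and hx).exists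
  have hjx' : ∀ N : ℕ, ∑ k ∈ Finset.range N, h (m j) (T^[k] x) ≤ (1 / 2 : ℝ) ^ j * N := by
    intro N
    by_contra hcon
    exact hjx ⟨N, not_le.1 hcon⟩
  set g : X → 𝕜 := fun z => (m j : 𝕜)⁻¹ * ∑ k ∈ Finset.range (m j), birkhoffSum T F k z with hg
  have hgb : ∃ G : ℝ, ∀ z, ‖g z‖ ≤ G := by
    refine ⟨‖(m j : 𝕜)⁻¹‖ * ∑ k ∈ Finset.range (m j), k * B, fun z => ?_⟩
    rw [hg, norm_mul]
    gcongr
    refine norm_sum_le_of_le _ fun k _ => ?_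
    refine (norm_sum_le_of_le _ fun i _ => hB _).trans ?_
    simp
  obtain ⟨G, hG⟩ := hgb
  have hdec : ∀ n, F (T^[n] x) - p x =
      (birkhoffAverage 𝕜 T F (m j) (T^[n] x) - p (T^[n] x)) +
        (g (T^[n] x) - g (T^[n + 1] x)) := fun n => by
    have h1 := sub_birkhoffAverage_eq (T := T) F (hm0 j) (T^[n] x)
    rw [← Function.iterate_succ_apply' T n x] at h1
    rw [show p (T^[n] x) = p x from hinv n]
    linear_combination h1
  have hcob : Tendsto (fun N : ℕ => (∑ n ∈ Finset.range N, v n)⁻¹ *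
      (2 * G * (‖w x 0‖ + ∑ n ∈ Finset.range N, ‖w x (n + 1) - w x n‖))) atTop (𝓝 0) := by
    have h1 := (((hsum.inv_tendsto_atTop).mul_const ‖w x 0‖).add (hw' x)).const_mul (2 * G)
    rw [zero_mul, zero_add, mul_zero] at h1
    refine h1.congr fun N => ?_
    simp only [Pi.inv_apply]
    ring
  have hev := (hcob.eventually_lt_const (half_pos hε)).and (hsum.eventually_gt_atTop 0)
  obtain ⟨N₀, hN₀⟩ := eventually_atTop.1 hev
  refine ⟨N₀, fun N hN => ?_⟩
  obtain ⟨hN1, hN2⟩ := hN₀ N (le_of_lt hN)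
  set W := ∑ n ∈ Finset.range N, v n
  rw [dist_zero_right, norm_smul, norm_inv, Real.norm_of_nonneg hN2.le]
  simp only [hdec, mul_add, Finset.sum_add_distrib]
  have b1 : ‖∑ n ∈ Finset.range N,
      w x n * (birkhoffAverage 𝕜 T F (m j) (T^[n] x) - p (T^[n] x))‖ ≤
      C * ((1 / 2 : ℝ) ^ j * W) := by
    refine le_trans ?_ (mul_le_mul_of_nonneg_left (sum_antitone_mul_le hv hv0 hjx' N) hC)
    rw [Finset.mul_sum]
    refine norm_sum_le_of_le _ fun n _ => ?_
    rw [norm_mul, ← mul_assoc]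
    exact mul_le_mul_of_nonneg_right (hw x n) (norm_nonneg _)
  have b2 := norm_sum_mul_sub_succ_le (w := w x) (b := fun n => g (T^[n] x))
    (fun n => hG _) N
  calc _ ≤ W⁻¹ * (C * ((1 / 2 : ℝ) ^ j * W) +
        2 * G * (‖w x 0‖ + ∑ n ∈ Finset.range N, ‖w x (n + 1) - w x n‖)) := by
        gcongr
        exact (norm_add_le _ _).trans (add_le_add b1 b2)
    _ = C * (1 / 2 : ℝ) ^ j + W⁻¹ *
        (2 * G * (‖w x 0‖ + ∑ n ∈ Finset.range N, ‖w x (n + 1) - w x n‖)) := by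
        field_simp
    _ < ε := by linarith

/-- Birkhoff's pointwise ergodic theorem for bounded functions. -/
theorem ae_tendsto_birkhoff [IsProbabilityMeasure μ]
    (hT : MeasurePreserving T μ μ) {F : X → 𝕜} (hFm : Measurable F) {B : ℝ}
    (hB : ∀ x, ‖F x‖ ≤ B) (hF : MemLp F 2 μ) :
    ∀ᵐ x ∂μ, Tendsto (fun N : ℕ => (N : ℝ)⁻¹ • ∑ n ∈ Finset.range N, F (T^[n] x)) atTop
      (𝓝 (invariantProj hT hF x)) := by
  -- Constant weights have zero variation.
  have h := ae_tendsto_weighted_sub_invariantProj hT hFm hB hF (v := fun _ => 1)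
    antitone_const (fun _ => zero_le_one) (by simpa using tendsto_natCast_atTop_atTop)
    (w := fun _ _ => 1) zero_le_one (by simp) (by simp)
  filter_upwards [h] with x hx
  rw [← tendsto_sub_nhds_zero_iff]
  refine hx.congr' ?_
  filter_upwards [eventually_ne_atTop 0] with N hN
  have hN' : (N : ℝ) ≠ 0 := Nat.cast_ne_zero.2 hN
  simp only [one_mul, Finset.sum_sub_distrib, Finset.sum_const, Finset.card_range, nsmul_eq_mul,
    mul_one, smul_sub, sub_right_inj]
  rw [← nsmul_eq_mul, ← Nat.cast_smul_eq_nsmul ℝ, smul_smul, inv_mul_cancel₀ hN', one_smul]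

/-- The second moment of a sum `∑ y n F (T^{s n} x)` is controlled by the lag energy. -/
theorem integral_norm_sum_sq_le_lagEnergy [IsProbabilityMeasure μ]
    (hT : MeasurePreserving T μ μ) {F : X → 𝕜} (hFm : Measurable F) {B : ℝ}
    (hB : ∀ x, ‖F x‖ ≤ B) {s : ℕ → ℕ} (hs : Monotone s) (hs' : ∀ n, s n ≤ n) (y : ℕ → ℝ)
    (N : ℕ) :
    ∫ x, ‖∑ n ∈ Finset.range N, y n • F (T^[s n] x)‖ ^ 2 ∂μ ≤ B ^ 2 * lagEnergy s y N := by
  have hFT : ∀ k, Measurable fun x => F (T^[k] x) := fun k => hFm.comp (hT.measurable.iterate k)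
  let c : ℕ → ℝ := fun j => ∫ x, RCLike.re (inner 𝕜 (F x) (F (T^[j] x))) ∂μ
  have hb : ∀ x z, ‖RCLike.re (inner 𝕜 (F x) (F z))‖ ≤ B ^ 2 := fun x z => by
    refine (RCLike.norm_re_le_norm _).trans ((norm_inner_le_norm _ _).trans ?_)
    rw [sq]
    gcongr
    · exact (norm_nonneg _).trans (hB x)
    · exact hB _
    · exact hB _
  have hm : ∀ i j, Measurable fun x => RCLike.re (inner 𝕜 (F (T^[i] x)) (F (T^[j] x))) :=
    fun i j => RCLike.measurable_re.comp ((hFT i).inner (hFT j))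
  have hi : ∀ i j, Integrable (fun x => RCLike.re (inner 𝕜 (F (T^[i] x)) (F (T^[j] x)))) μ :=
    fun i j => Integrable.of_bound (hm i j).aestronglyMeasurable (B ^ 2)
      (Eventually.of_forall fun x => hb _ _)
  have hc : ∀ j, |c j| ≤ B ^ 2 := fun j => by
    have := norm_integral_le_of_norm_le_const (μ := μ)
      (Eventually.of_forall fun x => hb x (T^[j] x))
    simpa only [Real.norm_eq_abs, probReal_univ, mul_one] using this
  -- Invariance of `μ` makes correlations depend on `j - i` only, the form required by
  -- `quadratic_le_lagEnergy`.
  have hshift : ∀ i j, i ≤ j →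
      ∫ x, RCLike.re (inner 𝕜 (F (T^[i] x)) (F (T^[j] x))) ∂μ = c (j - i) := fun i j hij => by
    have h1 := integral_map (μ := μ) (hT.iterate i).measurable.aemeasurable
      (f := fun x => RCLike.re (inner 𝕜 (F x) (F (T^[j - i] x))))
      (hm 0 (j - i)).aestronglyMeasurable
    rw [(hT.iterate i).map_eq] at h1
    rw [show c (j - i) = _ from h1]
    simp only [← Function.iterate_add_apply, Nat.sub_add_cancel hij]
  have hsq : ∀ x, ‖F x‖ ^ 2 = RCLike.re (inner 𝕜 (F x) (F x)) := fun x =>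
    (inner_self_eq_norm_sq (𝕜 := 𝕜) (F x)).symm
  refine le_trans (le_of_eq ?_) (quadratic_le_lagEnergy hs hs' y hc N)
  simp only [norm_sum_smul_sq, hsq]
  rw [integral_add, integral_finsetSum, integral_const_mul, integral_finsetSum]
  · congr 1
    · refine Finset.sum_congr rfl fun n _ => ?_
      rw [integral_const_mul, hshift _ _ le_rfl, Nat.sub_self]
    · congr 1
      refine Finset.sum_congr rfl fun n _ => ?_
      rw [integral_finsetSum _ fun m _ => (hi _ _).const_mul _]
      refine Finset.sum_congr rfl fun m hmn => ?_
      rw [integral_const_mul, hshift _ _ (hs (Finset.mem_range.1 hmn).le)]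
  · exact fun n _ => integrable_finsetSum _ fun m _ => (hi _ _).const_mul _
  · exact fun n _ => (hi _ _).const_mul _
  · exact integrable_finsetSum _ fun n _ => (hi _ _).const_mul _
  · exact (integrable_finsetSum _ fun n _ =>
      integrable_finsetSum _ fun m _ => (hi _ _).const_mul _).const_mul _

/-- Nonnegative functions with summable integrals are summable almost everywhere. -/
theorem ae_summable_of_summable_integral {f : ℕ → X → ℝ} (hf : ∀ i, Integrable (f i) μ)
    (hf0 : ∀ i x, 0 ≤ f i x) {b : ℕ → ℝ} (hb : Summable b) (hfb : ∀ i, ∫ x, f i x ∂μ ≤ b i) :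
    ∀ᵐ x ∂μ, Summable fun i => f i x := by
  have hb0 : ∀ i, 0 ≤ b i := fun i => (integral_nonneg (hf0 i)).trans (hfb i)
  have h1 : ∫⁻ x, ∑' i, ENNReal.ofReal (f i x) ∂μ ≠ ⊤ := by
    rw [lintegral_tsum fun i => (hf i).aestronglyMeasurable.aemeasurable.ennreal_ofReal]
    refine ne_top_of_le_ne_top (b := ∑' i, ENNReal.ofReal (b i)) ?_
      (ENNReal.tsum_le_tsum fun i => ?_)
    · rw [← ENNReal.ofReal_tsum_of_nonneg hb0 hb]
      exact ENNReal.ofReal_ne_top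
    · rw [← ofReal_integral_eq_lintegral_ofReal (hf i) (Eventually.of_forall (hf0 i))]
      exact ENNReal.ofReal_le_ofReal (hfb i)
  have h2 := ae_lt_top' (AEMeasurable.tsum fun i =>
    (hf i).aestronglyMeasurable.aemeasurable.ennreal_ofReal) h1
  filter_upwards [h2] with x hx
  have := ENNReal.summable_toReal hx.ne
  simpa [ENNReal.toReal_ofReal (hf0 _ x)] using this

end Ergodic

/-! ### Bounding the lag energy by sums of squares. -/

section Fibers

/-- The sum of `y m` over `m < n` with `s m = k`. -/
def fiberSum (s : ℕ → ℕ) (y : ℕ → ℝ) (n k : ℕ) : ℝ :=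
  ∑ m ∈ Finset.range n, if s m = k then y m else 0

/-- For fixed `n`, lag `j` is the fiber over `s n - j`; reversing the index turns one family into
the other, and lags beyond `s n` are empty. -/
theorem sum_lagPart_sq_le (s : ℕ → ℕ) (y : ℕ → ℝ) {n R : ℕ} (hR : s n < R) :
    ∑ j ∈ Finset.range R, lagPart s y n j ^ 2 ≤ ∑ k ∈ Finset.range R, fiberSum s y n k ^ 2 := by
  have hsub : Finset.range (s n + 1) ⊆ Finset.range R := Finset.range_subset_range.2 hR
  have h1 : ∑ j ∈ Finset.range R, lagPart s y n j ^ 2 =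
      ∑ j ∈ Finset.range (s n + 1), lagPart s y n j ^ 2 := by
    refine (Finset.sum_subset hsub fun j _ hj => ?_).symm
    rw [Finset.mem_range, not_lt] at hj
    have : lagPart s y n j = 0 := Finset.sum_eq_zero fun m _ => if_neg (by omega)
    rw [this, sq, zero_mul]
  have h2 : ∀ j ∈ Finset.range (s n + 1),
      lagPart s y n j ^ 2 = fiberSum s y n (s n + 1 - 1 - j) ^ 2 := fun j hj => by
    rw [Finset.mem_range] at hj
    congr 1
    refine Finset.sum_congr rfl fun m _ => ?_
    congr 1
    rw [eq_iff_iff]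
    omega
  rw [h1, Finset.sum_congr rfl h2, Finset.sum_range_reflect (fun k => fiberSum s y n k ^ 2)]
  exact Finset.sum_le_sum_of_subset_of_nonneg hsub fun k _ _ => sq_nonneg _

theorem sum_fiberSum_succ_sq (s : ℕ → ℕ) (y : ℕ → ℝ) {n R : ℕ} (hR : s n < R) :
    ∑ k ∈ Finset.range R, fiberSum s y (n + 1) k ^ 2 =
      ∑ k ∈ Finset.range R, fiberSum s y n k ^ 2 + 2 * (fiberSum s y n (s n) * y n) + y n ^ 2 := by
  have h1 : ∀ k, fiberSum s y (n + 1) k ^ 2 = fiberSum s y n k ^ 2 +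
      if s n = k then 2 * (fiberSum s y n (s n) * y n) + y n ^ 2 else 0 := fun k => by
    rw [fiberSum, Finset.sum_range_succ, ← fiberSum]
    split_ifs with h
    · rw [← h]; ring
    · ring
  simp only [h1, Finset.sum_add_distrib]
  rw [Finset.sum_ite_eq, if_pos (Finset.mem_range.2 hR), add_assoc]

theorem lagSum_eq_zero {s : ℕ → ℕ} (hs : Monotone s) (y : ℕ → ℝ) {N j : ℕ} (hj : s N < j) :
    lagSum s y N j = 0 := by
  refine Finset.sum_eq_zero fun n hn => ?_
  have h1 := hs (Finset.mem_range.1 hn).le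
  have : lagPart s y n j = 0 := Finset.sum_eq_zero fun m _ => if_neg (by omega)
  rw [this, mul_zero]

/-- Uses `2 * |x| ≤ a + a⁻¹ * x ^ 2`, where the term `a` is paid only for the at most `s N + 1` lags
that can occur. That this count is of order `W N` rather than `N` is essential. -/
theorem lagEnergy_le {s : ℕ → ℕ} (hs : Monotone s) (y : ℕ → ℝ) (N : ℕ) {a : ℝ} (ha : 0 < a) :
    lagEnergy s y N ≤ ∑ n ∈ Finset.range N, y n ^ 2 + a * (s N + 1) +
      a⁻¹ * ∑ j ∈ Finset.range N, lagSum s y N j ^ 2 := by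
  have h1 : ∀ j, 2 * |lagSum s y N j| ≤ a * (if j ∈ Finset.range (s N + 1) then 1 else 0) +
      a⁻¹ * lagSum s y N j ^ 2 := fun j => by
    split_ifs with h
    · rw [← sq_abs]
      have h2 : 0 ≤ a⁻¹ * (a - |lagSum s y N j|) ^ 2 := by positivity
      have h3 : a⁻¹ * (a - |lagSum s y N j|) ^ 2 =
          a - 2 * |lagSum s y N j| + a⁻¹ * |lagSum s y N j| ^ 2 := by field_simp; ring
      linarith
    · rw [lagSum_eq_zero hs y (by simpa [Nat.lt_succ_iff] using h)]
      simp
  have h2 : 2 * ∑ j ∈ Finset.range N, |lagSum s y N j| ≤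
      a * (s N + 1) + a⁻¹ * ∑ j ∈ Finset.range N, lagSum s y N j ^ 2 := by
    rw [Finset.mul_sum]
    refine (Finset.sum_le_sum fun j _ => h1 j).trans ?_
    rw [Finset.sum_add_distrib, ← Finset.mul_sum, ← Finset.mul_sum, ← Finset.sum_filter]
    gcongr
    rw [Finset.sum_const, nsmul_eq_mul, mul_one]
    have : (Finset.filter (· ∈ Finset.range (s N + 1)) (Finset.range N)).card ≤ s N + 1 := by
      refine (Finset.card_le_card (t := Finset.range (s N + 1)) fun j hj => ?_).trans_eq
        (Finset.card_range _)
      exact (Finset.mem_filter.1 hj).2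
    exact_mod_cast this
  rw [lagEnergy]
  linarith

end Fibers

/-! ### Expected lag energy of a random selection. -/

section Probability

variable {Ω : Type*} {V : ℕ → Ω → ℕ} {v : ℕ → ℝ}

/-- The values of the first `n` variables. -/
def history (V : ℕ → Ω → ℕ) (n : ℕ) (ω : Ω) : Finset.range n → ℕ := fun i => V i ω

/-- The number of selections before time `n`. -/
def partialCount (V : ℕ → Ω → ℕ) (ω : Ω) (n : ℕ) : ℕ := ∑ k ∈ Finset.range n, V k ω

/-- The selections, centered at their probabilities. -/
def centered (V : ℕ → Ω → ℕ) (v : ℕ → ℝ) (ω : Ω) (n : ℕ) : ℝ := V n ω - v n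

/-- Factoring through `history V n` plays the role of measurability at time `n` in a filtration.
Histories form a countable discrete space, so measurability is automatic. -/
theorem factorsThrough_history {β : Type*} {n : ℕ} {φ : Ω → β}
    (h : ∀ a b, (∀ k < n, V k a = V k b) → φ a = φ b) : φ.FactorsThrough (history V n) :=
  fun a b hab => h a b fun k hk => congrFun hab ⟨k, Finset.mem_range.2 hk⟩

theorem partialCount_congr {n : ℕ} {a b : Ω} (h : ∀ k < n, V k a = V k b) {i : ℕ} (hi : i ≤ n) :
    partialCount V a i = partialCount V b i :=
  Finset.sum_congr rfl fun k hk => h k (by rw [Finset.mem_range] at hk; omega)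

theorem centered_congr {n : ℕ} {a b : Ω} (h : ∀ k < n, V k a = V k b) {i : ℕ} (hi : i < n) :
    centered V v a i = centered V v b i := by
  rw [centered, h i hi, centered]

theorem fiberSum_congr {n : ℕ} {a b : Ω} (h : ∀ k < n, V k a = V k b) {i : ℕ} (hi : i ≤ n)
    (k : ℕ) : fiberSum (partialCount V a) (centered V v a) i k =
      fiberSum (partialCount V b) (centered V v b) i k :=
  Finset.sum_congr rfl fun m hm => by
    rw [Finset.mem_range] at hm
    rw [partialCount_congr h (by omega), centered_congr h (by omega)]

theorem lagPart_congr {n : ℕ} {a b : Ω} (h : ∀ k < n, V k a = V k b) {i : ℕ} (hi : i ≤ n)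
    (j : ℕ) : lagPart (partialCount V a) (centered V v a) i j =
      lagPart (partialCount V b) (centered V v b) i j :=
  Finset.sum_congr rfl fun m hm => by
    rw [Finset.mem_range] at hm
    rw [partialCount_congr h (by omega : m ≤ n), partialCount_congr h hi,
      centered_congr h (by omega)]

theorem lagSum_congr {n : ℕ} {a b : Ω} (h : ∀ k < n, V k a = V k b) {i : ℕ} (hi : i ≤ n)
    (j : ℕ) : lagSum (partialCount V a) (centered V v a) i j =
      lagSum (partialCount V b) (centered V v b) i j :=
  Finset.sum_congr rfl fun m hm => by
    rw [Finset.mem_range] at hm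
    rw [lagPart_congr h (by omega), centered_congr h (by omega)]

theorem lagEnergy_congr {n : ℕ} {a b : Ω} (h : ∀ k < n, V k a = V k b) :
    lagEnergy (partialCount V a) (centered V v a) n =
      lagEnergy (partialCount V b) (centered V v b) n := by
  simp only [lagEnergy, lagSum_congr h le_rfl]
  rw [Finset.sum_congr rfl fun m hm => by rw [centered_congr h (Finset.mem_range.1 hm)]]

theorem partialCount_monotone (V : ℕ → Ω → ℕ) (ω : Ω) : Monotone (partialCount V ω) :=
  monotone_nat_of_le_succ fun n => by rw [partialCount, partialCount, Finset.sum_range_succ]; omega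

theorem partialCount_le (h01 : ∀ n ω, V n ω = 0 ∨ V n ω = 1) (ω : Ω) (n : ℕ) :
    partialCount V ω n ≤ n := by
  calc partialCount V ω n ≤ ∑ k ∈ Finset.range n, 1 :=
        Finset.sum_le_sum fun k _ => by rcases h01 k ω with h | h <;> omega
    _ = n := by simp

section History

variable [MeasurableSpace Ω] {P : Measure Ω} (hVm : ∀ n, Measurable (V n)) (h01 : ∀ n ω, V n ω = 0 ∨ V n ω = 1)
include hVm

theorem measurable_of_factorsThrough_history {φ : Ω → ℝ} {n : ℕ}
    (hφ : φ.FactorsThrough (history V n)) : Measurable φ := by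
  have h : φ = Function.extend (history V n) φ 0 ∘ history V n :=
    funext fun ω => (hφ.extend_apply 0 ω).symm
  rw [h]
  exact (measurable_of_countable _).comp (measurable_pi_iff.2 fun i => hVm i)

theorem indepFun_of_factorsThrough_history (hind : iIndepFun V P) {φ : Ω → ℝ} {n : ℕ}
    (hφ : φ.FactorsThrough (history V n)) : IndepFun φ (V n) P := by
  have h : φ = Function.extend (history V n) φ 0 ∘ history V n :=
    funext fun ω => (hφ.extend_apply 0 ω).symm
  rw [h]
  have h1 := hind.indepFun_finset (Finset.range n) {n} (by simp) hVm
  exact h1.comp (measurable_of_countable _)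
    (measurable_pi_apply (⟨n, Finset.mem_singleton_self n⟩ : ({n} : Finset ℕ)))

include h01

/-- Only finitely many histories of length `n` occur, so such functions are bounded. -/
theorem integrable_of_factorsThrough_history [IsFiniteMeasure P] {φ : Ω → ℝ} {n : ℕ}
    (hφ : φ.FactorsThrough (history V n)) : Integrable φ P := by
  have h : φ = Function.extend (history V n) φ 0 ∘ history V n :=
    funext fun ω => (hφ.extend_apply 0 ω).symm
  have hfin : (Set.pi Set.univ fun _ : Finset.range n => ({0, 1} : Set ℕ)).Finite :=
    Set.Finite.pi fun _ => Set.toFinite _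
  obtain ⟨C, hC⟩ := (hfin.image fun z => ‖Function.extend (history V n) φ 0 z‖).bddAbove
  refine Integrable.of_bound
    (measurable_of_factorsThrough_history hVm hφ).aestronglyMeasurable C
    (Eventually.of_forall fun ω => ?_)
  rw [h]
  exact hC ⟨history V n ω, fun i _ => h01 i ω, rfl⟩

theorem integrable_selection [IsProbabilityMeasure P] (n : ℕ) : Integrable (fun ω => (V n ω : ℝ)) P :=
  integrable_of_factorsThrough_history hVm h01 (n := n + 1)
    (factorsThrough_history fun a b h => by rw [h n n.lt_succ_self])

theorem integrable_lagEnergy [IsProbabilityMeasure P] (N : ℕ) :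
    Integrable (fun ω => lagEnergy (partialCount V ω) (centered V v ω) N) P :=
  integrable_of_factorsThrough_history hVm h01 (n := N)
    (factorsThrough_history fun _ _ h => lagEnergy_congr h)

variable [IsProbabilityMeasure P] (hind : iIndepFun V P) (hp : ∀ n, P.real {ω | V n ω = 1} = v n)
include hp

omit [IsProbabilityMeasure P] in
theorem integral_selection (n : ℕ) : ∫ ω, (V n ω : ℝ) ∂P = v n := by
  have h : (fun ω => (V n ω : ℝ)) = Set.indicator {ω | V n ω = 1} 1 := funext fun ω => by
    rcases h01 n ω with h | h <;> simp [Set.indicator, h]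
  rw [h]
  exact (integral_indicator_one (hVm n (measurableSet_singleton 1))).trans (hp n)

include hind

/-- Martingale orthogonality: `φ` is known before time `n`, while the centered `V n` is independent
of that past and has mean zero. This kills every cross term below. -/
theorem integral_mul_centered {φ : Ω → ℝ} {n : ℕ} (hφ : φ.FactorsThrough (history V n)) :
    ∫ ω, φ ω * centered V v ω n ∂P = 0 := by
  have h1 := (indepFun_of_factorsThrough_history hVm hind hφ).comp (ψ := fun k : ℕ => (k : ℝ) - v n)
    measurable_id (measurable_of_countable _)
  have h2 := h1.integral_fun_mul_eq_mul_integral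
    (measurable_of_factorsThrough_history hVm hφ).aestronglyMeasurable
    ((measurable_of_countable _).comp (hVm n)).aestronglyMeasurable
  have h3 : ∫ ω, ((fun k : ℕ => (k : ℝ) - v n) ∘ V n) ω ∂P = 0 := by
    simp only [Function.comp_apply]
    rw [integral_sub (integrable_selection hVm h01 n) (integrable_const _),
      integral_selection hVm h01 hp]
    simp
  rw [h3, mul_zero] at h2
  exact h2

theorem integral_mul_centered_sq_le {φ : Ω → ℝ} {n : ℕ} (hφ : φ.FactorsThrough (history V n))
    (hφ0 : ∀ ω, 0 ≤ φ ω) :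
    ∫ ω, φ ω * centered V v ω n ^ 2 ∂P ≤ v n * ∫ ω, φ ω ∂P := by
  have h1 := (indepFun_of_factorsThrough_history hVm hind hφ).comp
    (ψ := fun k : ℕ => ((k : ℝ) - v n) ^ 2) measurable_id (measurable_of_countable _)
  have h2 := h1.integral_fun_mul_eq_mul_integral
    (measurable_of_factorsThrough_history hVm hφ).aestronglyMeasurable
    ((measurable_of_countable _).comp (hVm n)).aestronglyMeasurable
  have h3 : ∫ ω, ((fun k : ℕ => ((k : ℝ) - v n) ^ 2) ∘ V n) ω ∂P ≤ v n := by
    -- The square is linear in `V n` because `V n ^ 2 = V n`; the variance is `v n - v n ^ 2`.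
    have e : ((fun k : ℕ => ((k : ℝ) - v n) ^ 2) ∘ V n) =
        fun ω => (1 - 2 * v n) * (V n ω : ℝ) + v n ^ 2 := funext fun ω => by
      rcases h01 n ω with h | h <;> (simp [h]; try ring)
    rw [e, integral_add ((integrable_selection hVm h01 n).const_mul _) (integrable_const _),
      integral_const_mul, integral_selection hVm h01 hp]
    simp
    nlinarith [sq_nonneg (v n)]
  calc _ = (∫ ω, φ ω ∂P) * ∫ ω, ((fun k : ℕ => ((k : ℝ) - v n) ^ 2) ∘ V n) ω ∂P := h2
    _ ≤ (∫ ω, φ ω ∂P) * v n := mul_le_mul_of_nonneg_left h3 (integral_nonneg hφ0)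
    _ = _ := mul_comm _ _

/-- Time `n` changes only the fiber over `s n`, whose previous sum is known by then. The cross term
has mean zero and the new square costs at most `v n`. -/
theorem integral_sum_fiberSum_sq_le {n R : ℕ} (hR : n ≤ R) :
    ∫ ω, ∑ k ∈ Finset.range R, fiberSum (partialCount V ω) (centered V v ω) n k ^ 2 ∂P ≤
      ∑ m ∈ Finset.range n, v m := by
  induction n with
  | zero => simp [fiberSum]
  | succ n ih =>
    have e : ∀ ω, partialCount V ω n < R := fun ω => by
      have := partialCount_le h01 ω n
      omega
    simp only [sum_fiberSum_succ_sq _ _ (e _)]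
    have i1 : Integrable (fun ω => ∑ k ∈ Finset.range R,
        fiberSum (partialCount V ω) (centered V v ω) n k ^ 2) P :=
      integrable_of_factorsThrough_history hVm h01 (n := n)
        (factorsThrough_history fun a b h => by simp only [fiberSum_congr h le_rfl])
    have f2 : (fun ω => fiberSum (partialCount V ω) (centered V v ω) n
        (partialCount V ω n)).FactorsThrough (history V n) :=
      factorsThrough_history fun a b h => by
        simp only [fiberSum_congr h le_rfl, partialCount_congr h le_rfl]
    have i2 : Integrable (fun ω => fiberSum (partialCount V ω) (centered V v ω) n
        (partialCount V ω n) * centered V v ω n) P :=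
      integrable_of_factorsThrough_history hVm h01 (n := n + 1)
        (factorsThrough_history fun a b h => by
          simp only [fiberSum_congr h n.le_succ, partialCount_congr h n.le_succ,
            centered_congr h n.lt_succ_self])
    have i3 : Integrable (fun ω => centered V v ω n ^ 2) P :=
      integrable_of_factorsThrough_history hVm h01 (n := n + 1)
        (factorsThrough_history fun a b h => by simp only [centered_congr h n.lt_succ_self])
    rw [integral_add (i1.fun_add (i2.const_mul 2)) i3, integral_add i1 (i2.const_mul 2),
      integral_const_mul, integral_mul_centered hVm h01 hind hp f2, Finset.sum_range_succ]
    have h3 := integral_mul_centered_sq_le hVm h01 hind hp (φ := fun _ => 1) (n := n)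
      (fun _ _ _ => rfl) (fun _ => zero_le_one)
    simp only [one_mul, integral_const, probReal_univ, smul_eq_mul, mul_one] at h3
    have := ih (by omega)
    linarith

/-- The increments `y n * lagPart s y n j` are martingale differences, since `lagPart` at `n` uses
only times before `n`. -/
theorem integral_lagSum_sq_le (N j : ℕ) :
    ∫ ω, lagSum (partialCount V ω) (centered V v ω) N j ^ 2 ∂P ≤
      ∑ n ∈ Finset.range N,
        v n * ∫ ω, lagPart (partialCount V ω) (centered V v ω) n j ^ 2 ∂P := by
  induction N with
  | zero => simp [lagSum]
  | succ n ih =>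
    have e : ∀ ω, lagSum (partialCount V ω) (centered V v ω) (n + 1) j ^ 2 =
        lagSum (partialCount V ω) (centered V v ω) n j ^ 2 +
        2 * (lagSum (partialCount V ω) (centered V v ω) n j *
          lagPart (partialCount V ω) (centered V v ω) n j * centered V v ω n) +
        lagPart (partialCount V ω) (centered V v ω) n j ^ 2 * centered V v ω n ^ 2 := fun ω => by
      rw [lagSum, Finset.sum_range_succ, ← lagSum]
      ring
    simp only [e]
    have f2 : (fun ω => lagSum (partialCount V ω) (centered V v ω) n j *
        lagPart (partialCount V ω) (centered V v ω) n j).FactorsThrough (history V n) :=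
      factorsThrough_history fun a b h => by
        simp only [lagSum_congr h le_rfl, lagPart_congr h le_rfl]
    have f3 : (fun ω => lagPart (partialCount V ω) (centered V v ω) n j ^ 2).FactorsThrough
        (history V n) :=
      factorsThrough_history fun a b h => by simp only [lagPart_congr h le_rfl]
    have i1 : Integrable (fun ω => lagSum (partialCount V ω) (centered V v ω) n j ^ 2) P :=
      integrable_of_factorsThrough_history hVm h01 (n := n)
        (factorsThrough_history fun a b h => by simp only [lagSum_congr h le_rfl])
    have i2 : Integrable (fun ω => lagSum (partialCount V ω) (centered V v ω) n j *
        lagPart (partialCount V ω) (centered V v ω) n j * centered V v ω n) P :=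
      integrable_of_factorsThrough_history hVm h01 (n := n + 1)
        (factorsThrough_history fun a b h => by
          simp only [lagSum_congr h n.le_succ, lagPart_congr h n.le_succ,
            centered_congr h n.lt_succ_self])
    have i3 : Integrable (fun ω => lagPart (partialCount V ω) (centered V v ω) n j ^ 2 *
        centered V v ω n ^ 2) P :=
      integrable_of_factorsThrough_history hVm h01 (n := n + 1)
        (factorsThrough_history fun a b h => by
          simp only [lagPart_congr h n.le_succ, centered_congr h n.lt_succ_self])
    rw [integral_add (i1.fun_add (i2.const_mul 2)) i3, integral_add i1 (i2.const_mul 2),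
      integral_const_mul, integral_mul_centered hVm h01 hind hp f2, Finset.sum_range_succ]
    have h3 := integral_mul_centered_sq_le hVm h01 hind hp f3 (fun _ => sq_nonneg _)
    linarith

theorem sum_integral_lagSum_sq_le (N : ℕ) :
    ∑ j ∈ Finset.range N, ∫ ω, lagSum (partialCount V ω) (centered V v ω) N j ^ 2 ∂P ≤
      (∑ n ∈ Finset.range N, v n) ^ 2 := by
  have hv0 : ∀ n, 0 ≤ v n := fun n => hp n ▸ measureReal_nonneg
  calc _ ≤ ∑ j ∈ Finset.range N, ∑ n ∈ Finset.range N,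
        v n * ∫ ω, lagPart (partialCount V ω) (centered V v ω) n j ^ 2 ∂P :=
        Finset.sum_le_sum fun j _ => integral_lagSum_sq_le hVm h01 hind hp N j
    _ = ∑ n ∈ Finset.range N, v n * ∫ ω, ∑ j ∈ Finset.range N,
        lagPart (partialCount V ω) (centered V v ω) n j ^ 2 ∂P := by
        rw [Finset.sum_comm]
        refine Finset.sum_congr rfl fun n _ => ?_
        rw [← Finset.mul_sum, integral_finsetSum]
        exact fun j _ => integrable_of_factorsThrough_history hVm h01 (n := n)
          (factorsThrough_history fun a b h => by simp only [lagPart_congr h le_rfl])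
    _ ≤ ∑ n ∈ Finset.range N, v n * ∑ m ∈ Finset.range N, v m := by
        refine Finset.sum_le_sum fun n hn => mul_le_mul_of_nonneg_left ?_ (hv0 n)
        rw [Finset.mem_range] at hn
        refine le_trans ?_ ((integral_sum_fiberSum_sq_le hVm h01 hind hp hn.le).trans
          (Finset.sum_le_sum_of_subset_of_nonneg (Finset.range_subset_range.2 hn.le)
            fun m _ _ => hv0 m))
        refine integral_mono
          (integrable_of_factorsThrough_history hVm h01 (n := n)
            (factorsThrough_history fun a b h => by simp only [lagPart_congr h le_rfl]))
          (integrable_of_factorsThrough_history hVm h01 (n := n)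
            (factorsThrough_history fun a b h => by simp only [fiberSum_congr h le_rfl]))
          fun ω => sum_lagPart_sq_le _ _ ?_
        exact (partialCount_le h01 ω n).trans_lt hn
    _ = _ := by rw [← Finset.sum_mul, sq]

/-- Taking `a` of the order of the square root of `∑ v n` balances the last two terms and gives the
exponent `3/2`. -/
theorem integral_lagEnergy_le (N : ℕ) {a : ℝ} (ha : 0 < a) :
    ∫ ω, lagEnergy (partialCount V ω) (centered V v ω) N ∂P ≤
      ∑ n ∈ Finset.range N, v n + a * (∑ n ∈ Finset.range N, v n + 1) +
        a⁻¹ * (∑ n ∈ Finset.range N, v n) ^ 2 := by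
  have i1 : ∀ n ∈ Finset.range N, Integrable (fun ω => centered V v ω n ^ 2) P := fun n _ =>
    integrable_of_factorsThrough_history hVm h01 (n := n + 1)
      (factorsThrough_history fun a b h => by simp only [centered_congr h n.lt_succ_self])
  have i2 : Integrable (fun ω => (partialCount V ω N : ℝ)) P :=
    integrable_of_factorsThrough_history hVm h01 (n := N)
      (factorsThrough_history fun a b h => by simp only [partialCount_congr h le_rfl])
  have i3 : ∀ j ∈ Finset.range N,
      Integrable (fun ω => lagSum (partialCount V ω) (centered V v ω) N j ^ 2) P := fun j _ =>
    integrable_of_factorsThrough_history hVm h01 (n := N)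
      (factorsThrough_history fun a b h => by simp only [lagSum_congr h le_rfl])
  have i4 := (integrable_finsetSum _ i1).fun_add
    ((i2.fun_add (integrable_const (1 : ℝ))).const_mul a)
  have i5 := (integrable_finsetSum _ i3).const_mul a⁻¹
  refine (integral_mono (integrable_lagEnergy hVm h01 N) (i4.fun_add i5) fun ω =>
    lagEnergy_le (partialCount_monotone V ω) _ N ha).trans ?_
  rw [integral_add i4 i5]
  rw [integral_add (integrable_finsetSum _ i1)
    ((i2.fun_add (integrable_const (1 : ℝ))).const_mul a), integral_const_mul, integral_const_mul]
  rw [integral_add i2 (integrable_const _), integral_finsetSum _ i1, integral_finsetSum _ i3]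
  have e1 : ∑ n ∈ Finset.range N, ∫ ω, centered V v ω n ^ 2 ∂P ≤ ∑ n ∈ Finset.range N, v n :=
    Finset.sum_le_sum fun n _ => by
      have h3 := integral_mul_centered_sq_le hVm h01 hind hp (φ := fun _ => 1) (n := n)
        (fun _ _ _ => rfl) (fun _ => zero_le_one)
      simpa only [one_mul, integral_const, probReal_univ, smul_eq_mul, mul_one] using h3
  have e2 : ∫ ω, (partialCount V ω N : ℝ) ∂P = ∑ n ∈ Finset.range N, v n := by
    simp only [partialCount, Nat.cast_sum]
    rw [integral_finsetSum _ fun n _ => integrable_selection hVm h01 n]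
    exact Finset.sum_congr rfl fun n _ => integral_selection hVm h01 hp n
  have e3 := sum_integral_lagSum_sq_le hVm h01 hind hp N
  rw [e2, integral_const, probReal_univ, one_smul]
  gcongr

/-- Almost surely the normalised lag energy is summable along a sequence of quartic growth. -/
theorem ae_summable_lagEnergy {r : ℕ → ℕ}
    (hr1 : ∀ i : ℕ, ((i : ℝ) + 1) ^ 4 ≤ ∑ n ∈ Finset.range (r i), v n)
    (hr2 : ∀ i : ℕ, ∑ n ∈ Finset.range (r i), v n ≤ ((i : ℝ) + 1) ^ 4 + 1) :
    ∀ᵐ ω ∂P, Summable fun i => lagEnergy (partialCount V ω) (centered V v ω) (r i) /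
      (∑ n ∈ Finset.range (r i), v n) ^ 2 := by
  have hb : Summable fun i : ℕ => 9 * (1 / ((i : ℝ) + 1) ^ 2) := by
    have := (summable_nat_add_iff 1).2 (Real.summable_one_div_nat_pow.2 (by norm_num : 1 < 2))
    simpa using this.mul_left (9 : ℝ)
  refine ae_summable_of_summable_integral
    (fun i => (integrable_lagEnergy hVm h01 (r i)).div_const _)
    (fun i ω => ?_) hb fun i => ?_
  · rw [lagEnergy]
    positivity
  · rw [integral_div]
    have ha : (1 : ℝ) ≤ ((i : ℝ) + 1) ^ 2 := by
      have : (1 : ℝ) ≤ (i : ℝ) + 1 := by linarith [Nat.cast_nonneg (α := ℝ) i]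
      nlinarith
    -- This `a` is about the square root of `W`. The three terms are then at most `1`, `2` and `1`
    -- times `a⁻¹ * W ^ 2`, within the constant `9`.
    have h0 := integral_lagEnergy_le hVm h01 hind hp (r i) (a := ((i : ℝ) + 1) ^ 2) (by positivity)
    have h1 := hr1 i
    have h2 := hr2 i
    set W := ∑ n ∈ Finset.range (r i), v n
    have e4 : ((i : ℝ) + 1) ^ 4 = (((i : ℝ) + 1) ^ 2) ^ 2 := by ring
    rw [e4] at h1 h2
    set a := ((i : ℝ) + 1) ^ 2
    have hW : 0 < W := lt_of_lt_of_le (by positivity) h1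
    have haW : a ≤ W := le_trans (by nlinarith) h1
    have c1 : W ≤ a⁻¹ * W ^ 2 := by
      rw [inv_mul_eq_div, le_div_iff₀ (by positivity)]
      nlinarith
    have c2 : a * (W + 1) ≤ 2 * (a⁻¹ * W ^ 2) := by
      rw [inv_mul_eq_div, ← mul_div_assoc, le_div_iff₀ (by positivity)]
      have : a * (W + 1) * a ≤ a ^ 2 * (2 * W) := by
        have h1W : 1 ≤ W := ha.trans haW
        nlinarith [sq_nonneg a]
      nlinarith
    rw [div_le_iff₀ (by positivity), one_div]
    have c3 : 0 ≤ a⁻¹ * W ^ 2 := by positivity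
    linarith

end History

end Probability

/-! ### Shift of weights, and consequences of a good selection. -/

section Sequences

theorem tendsto_ratio_of_quartic {W : ℕ → ℝ} (hmono : ∀ i, W i ≤ W (i + 1))
    (h1 : ∀ i : ℕ, ((i : ℝ) + 1) ^ 4 ≤ W i) (h2 : ∀ i : ℕ, W i ≤ ((i : ℝ) + 1) ^ 4 + 1) :
    Tendsto (fun i => W (i + 1) / W i) atTop (𝓝 1) := by
  have hpos : ∀ i, 0 < W i := fun i => lt_of_lt_of_le (by positivity) (h1 i)
  have hz : Tendsto (fun i : ℕ => 1 / ((i : ℝ) + 1)) atTop (𝓝 0) :=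
    tendsto_one_div_add_atTop_nhds_zero_nat
  have hu : Tendsto (fun i : ℕ => (1 + 1 / ((i : ℝ) + 1)) ^ 4 + (1 / ((i : ℝ) + 1)) ^ 4)
      atTop (𝓝 1) := by
    simpa using ((hz.const_add 1).pow 4).add (hz.pow 4)
  refine tendsto_of_tendsto_of_tendsto_of_le_of_le tendsto_const_nhds hu
    (fun i => (one_le_div (hpos i)).2 (hmono i)) fun i => ?_
  have hi : (0 : ℝ) < (i : ℝ) + 1 := by positivity
  have e : (1 + 1 / ((i : ℝ) + 1)) ^ 4 + (1 / ((i : ℝ) + 1)) ^ 4 =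
      ((((i + 1 : ℕ) : ℝ) + 1) ^ 4 + 1) / ((i : ℝ) + 1) ^ 4 := by
    push_cast
    field_simp
  rw [e]
  exact div_le_div₀ (by positivity) (h2 (i + 1)) (by positivity) (h1 i)

theorem tendsto_zero_of_norm_sq {E : Type*} [NormedAddCommGroup E] {a : ℕ → E}
    (h : Tendsto (fun i => ‖a i‖ ^ 2) atTop (𝓝 0)) : Tendsto a atTop (𝓝 0) := by
  rw [tendsto_zero_iff_norm_tendsto_zero]
  have := (Real.continuous_sqrt.tendsto 0).comp h
  simpa [Function.comp_def, Real.sqrt_sq] using this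

theorem tendsto_inv_smul_of_bounded {E : Type*} [NormedAddCommGroup E] [NormedSpace ℝ E]
    {W : ℕ → ℝ} (hW : Tendsto W atTop atTop) {b : ℕ → E} {K : ℝ} (hb : ∀ N, ‖b N‖ ≤ K) :
    Tendsto (fun N => (W N)⁻¹ • b N) atTop (𝓝 0) :=
  (hW.inv_tendsto_atTop).zero_smul_isBoundedUnder_le (isBoundedUnder_of ⟨K, hb⟩)

/-- The total variation of `u` telescopes from index `1` on; the arbitrary value `u 0` contributes
one separate term. -/
theorem norm_sum_smul_sub_shift_le {E : Type*} [NormedAddCommGroup E] [NormedSpace ℝ E]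
    {u : ℕ → ℝ} (hu : Antitone fun n => u (n + 1)) (hu0 : ∀ n, 0 ≤ u (n + 1))
    {a : ℕ → E} {B : ℝ} (hB : ∀ n, ‖a n‖ ≤ B) (N : ℕ) :
    ‖∑ n ∈ Finset.range N, u n • a n - ∑ n ∈ Finset.range N, u (n + 1) • a n‖ ≤
      (|u 0 - u 1| + u 1) * B := by
  have hB0 : 0 ≤ B := (norm_nonneg _).trans (hB 0)
  have hvar : ∑ n ∈ Finset.range N, |u n - u (n + 1)| ≤ |u 0 - u 1| + u 1 := by
    cases N with
    | zero => simpa using add_nonneg (abs_nonneg (u 0 - u 1)) (hu0 0)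
    | succ N =>
      rw [Finset.sum_range_succ']
      have : ∀ n, |u (n + 1) - u (n + 1 + 1)| = u (n + 1) - u (n + 1 + 1) := fun n =>
        abs_of_nonneg (sub_nonneg.2 (hu n.le_succ))
      simp only [this, Finset.sum_range_sub' (fun n => u (n + 1))]
      have := hu0 N
      simp only [zero_add]
      linarith
  rw [← Finset.sum_sub_distrib]
  refine le_trans ?_ (mul_le_mul_of_nonneg_right hvar hB0)
  rw [Finset.sum_mul]
  refine norm_sum_le_of_le _ fun n _ => ?_
  rw [← sub_smul, norm_smul, Real.norm_eq_abs]
  exact mul_le_mul_of_nonneg_left (hB n) (abs_nonneg _)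

theorem tendsto_sum_shift {u : ℕ → ℝ} (hu : Antitone fun n => u (n + 1))
    (hu0 : ∀ n, 0 ≤ u (n + 1))
    (hsum : Tendsto (fun N : ℕ => ∑ n ∈ Finset.range N, u n) atTop atTop) :
    Tendsto (fun N : ℕ => ∑ n ∈ Finset.range N, u (n + 1)) atTop atTop := by
  refine tendsto_atTop_mono (fun N => ?_)
    (tendsto_atTop_add_const_right _ (-((|u 0 - u 1| + u 1) * 1)) hsum)
  have := (le_abs_self _).trans
    (norm_sum_smul_sub_shift_le hu hu0 (a := fun _ => (1 : ℝ)) (B := 1) (by simp) N)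
  simp only [smul_eq_mul, mul_one] at this ⊢
  linarith

/-- Weighted averages of bounded sequences are insensitive to a unit shift of the weights. -/
theorem tendsto_inv_smul_sum_of_shift {E : Type*} [NormedAddCommGroup E] [NormedSpace ℝ E]
    {u : ℕ → ℝ} (hu : Antitone fun n => u (n + 1)) (hu0 : ∀ n, 0 ≤ u (n + 1))
    (hsum : Tendsto (fun N : ℕ => ∑ n ∈ Finset.range N, u n) atTop atTop)
    {a : ℕ → E} {B : ℝ} (hB : ∀ n, ‖a n‖ ≤ B) {L : E}
    (h : Tendsto (fun N : ℕ => (∑ n ∈ Finset.range N, u (n + 1))⁻¹ •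
      ∑ n ∈ Finset.range N, u (n + 1) • a n) atTop (𝓝 L)) :
    Tendsto (fun N : ℕ => (∑ n ∈ Finset.range N, u n)⁻¹ •
      ∑ n ∈ Finset.range N, u n • a n) atTop (𝓝 L) := by
  have h1 := tendsto_inv_smul_of_bounded hsum (norm_sum_smul_sub_shift_le hu hu0 hB)
  have h2 := tendsto_inv_smul_of_bounded hsum
    (norm_sum_smul_sub_shift_le hu hu0 (a := fun _ => (1 : ℝ)) (B := 1) (by simp))
  have h3 := (((tendsto_const_nhds (x := (1 : ℝ))).sub h2).smul h).add h1
  rw [sub_zero, one_smul, add_zero] at h3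
  refine h3.congr' ?_
  filter_upwards [hsum.eventually_gt_atTop 0,
    (tendsto_sum_shift hu hu0 hsum).eventually_gt_atTop 0] with N hN hN'
  simp only [smul_eq_mul, mul_one]
  set W := ∑ n ∈ Finset.range N, u n
  set W' := ∑ n ∈ Finset.range N, u (n + 1)
  have e : (1 - W⁻¹ * (W - W')) = W⁻¹ * W' := by field_simp; ring
  rw [e, smul_smul, mul_assoc, mul_inv_cancel₀ hN'.ne', mul_one, ← smul_add, add_sub_cancel]

/-- What is used of a sequence of selections `e`: its centered version has summable normalised
lag energy along a subsequence of quartic growth. -/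
structure GoodSelection (v : ℕ → ℝ) (e : ℕ → ℕ) : Prop where
  antitone : Antitone v
  nonneg : ∀ n, 0 ≤ v n
  tendsto_zero : Tendsto v atTop (𝓝 0)
  tendsto_sum : Tendsto (fun N : ℕ => ∑ n ∈ Finset.range N, v n) atTop atTop
  zero_or_one : ∀ n, e n = 0 ∨ e n = 1
  exists_subseq : ∃ r : ℕ → ℕ, Monotone r ∧ Tendsto r atTop atTop ∧
    (∀ i : ℕ, ((i : ℝ) + 1) ^ 4 ≤ ∑ n ∈ Finset.range (r i), v n ∧
      ∑ n ∈ Finset.range (r i), v n ≤ ((i : ℝ) + 1) ^ 4 + 1) ∧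
    Summable fun i => lagEnergy (fun n => ∑ k ∈ Finset.range n, e k) (fun n => (e n : ℝ) - v n)
      (r i) / (∑ n ∈ Finset.range (r i), v n) ^ 2

namespace GoodSelection

variable {v : ℕ → ℝ} {e : ℕ → ℕ} (h : GoodSelection v e)
include h

theorem monotone_sum : Monotone fun N : ℕ => ∑ n ∈ Finset.range N, v n :=
  monotone_nat_of_le_succ fun n => by rw [Finset.sum_range_succ]; linarith [h.nonneg n]

omit h in
theorem monotone_count (e : ℕ → ℕ) : Monotone fun N : ℕ => ∑ n ∈ Finset.range N, e n :=
  monotone_nat_of_le_succ fun n => by rw [Finset.sum_range_succ]; omega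

theorem count_le (N : ℕ) : ∑ n ∈ Finset.range N, e n ≤ N := by
  calc ∑ n ∈ Finset.range N, e n ≤ ∑ n ∈ Finset.range N, 1 :=
        Finset.sum_le_sum fun k _ => by rcases h.zero_or_one k with h | h <;> omega
    _ = N := by simp

/-- Increments of sums with centered weights. -/
theorem norm_sum_centered_sub_le {𝕜 : Type*} [RCLike 𝕜] {a : ℕ → 𝕜} {B : ℝ}
    (hB : ∀ n, ‖a n‖ ≤ B) (M N : ℕ) (hMN : M ≤ N) :
    ‖∑ n ∈ Finset.range N, ((e n : ℝ) - v n) • a n -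
      ∑ n ∈ Finset.range M, ((e n : ℝ) - v n) • a n‖ ≤
      B * ∑ n ∈ Finset.range N, ((e n : ℝ) + v n) -
        B * ∑ n ∈ Finset.range M, ((e n : ℝ) + v n) := by
  rw [← mul_sub, Finset.sum_range_sub_sum_range hMN, Finset.sum_range_sub_sum_range hMN,
    Finset.mul_sum]
  refine norm_sum_le_of_le _ fun n _ => ?_
  rw [norm_smul, mul_comm]
  refine mul_le_mul (hB n) ?_ (norm_nonneg _) ((norm_nonneg _).trans (hB n))
  rw [Real.norm_eq_abs, abs_le]
  have := h.nonneg n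
  have : (0 : ℝ) ≤ e n := Nat.cast_nonneg _
  constructor <;> linarith

/-- The strong law of large numbers for the selections. -/
theorem tendsto_count_div : Tendsto (fun N : ℕ => ((∑ n ∈ Finset.range N, e n : ℕ) : ℝ) /
    ∑ n ∈ Finset.range N, v n) atTop (𝓝 1) := by
  obtain ⟨r, hr, hr', hrW, hE⟩ := h.exists_subseq
  set W : ℕ → ℝ := fun N => ∑ n ∈ Finset.range N, v n with hW
  have hpos : ∀ i, 0 < W (r i) := fun i => lt_of_lt_of_le (by positivity) (hrW i).1
  have hratio : Tendsto (fun i => W (r (i + 1)) / W (r i)) atTop (𝓝 1) :=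
    tendsto_ratio_of_quartic (W := fun i => W (r i))
      (fun i => h.monotone_sum (hr i.le_succ)) (fun i => (hrW i).1) (fun i => (hrW i).2)
  have hDr : Tendsto (fun i => (W (r i))⁻¹ •
      ∑ n ∈ Finset.range (r i), ((e n : ℝ) - v n) • (1 : ℝ)) atTop (𝓝 0) := by
    refine tendsto_zero_of_norm_sq
      (squeeze_zero (fun i => sq_nonneg _) (fun i => ?_) hE.tendsto_atTop_zero)
    rw [norm_smul, mul_pow, norm_inv, Real.norm_of_nonneg (hpos i).le, inv_pow, inv_mul_eq_div]
    refine div_le_div_of_nonneg_right ?_ (sq_nonneg _)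
    -- With all coefficients equal to `1` the form is the square of the centered sum, so the energy
    -- also controls the law of large numbers.
    have h1 := quadratic_le_lagEnergy (monotone_count e) h.count_le (fun n => (e n : ℝ) - v n)
      (c := fun _ => 1) (B := 1) (by simp) (r i)
    have h2 := norm_sum_smul_sq (𝕜 := ℝ) (fun n => (e n : ℝ) - v n) (fun _ => 1) (r i)
    rw [one_mul] at h1
    refine (h2.trans ?_).trans_le h1
    simp
  have hHr : Tendsto (fun i => (1 * ∑ n ∈ Finset.range (r i), ((e n : ℝ) + v n)) / W (r i))
      atTop (𝓝 2) := by
    have h1 := hDr.add_const 2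
    rw [zero_add] at h1
    refine h1.congr fun i => ?_
    have := (hpos i).ne'
    simp only [smul_eq_mul, mul_one, one_mul, Finset.sum_sub_distrib, Finset.sum_add_distrib]
    change (W (r i))⁻¹ * (_ - W (r i)) + 2 = (_ + W (r i)) / W (r i)
    field_simp
    ring
  have hD := tendsto_inv_smul_of_subseq
    (h.norm_sum_centered_sub_le (a := fun _ => (1 : ℝ)) (B := 1) (by simp))
    h.monotone_sum hr hr' hpos hratio hDr hHr
  have h1 := hD.add_const 1
  rw [zero_add] at h1
  refine h1.congr' ?_
  filter_upwards [h.tendsto_sum.eventually_gt_atTop 0] with N hN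
  simp only [smul_eq_mul, mul_one, Finset.sum_sub_distrib]
  push_cast
  field_simp
  ring

theorem tendsto_count : Tendsto (fun N : ℕ => ∑ n ∈ Finset.range N, e n) atTop atTop := by
  rw [← tendsto_natCast_atTop_iff (R := ℝ)]
  have := h.tendsto_count_div.pos_mul_atTop one_pos h.tendsto_sum
  refine this.congr' ?_
  filter_upwards [h.tendsto_sum.eventually_gt_atTop 0] with N hN
  rw [div_mul_cancel₀ _ hN.ne']

/-- Here `v → 0` enters: the numerator is `o(∑ e n)`, and `∑ e n` is asymptotic to the denominator.
-/
theorem tendsto_sum_mul_div : Tendsto (fun N : ℕ => (∑ n ∈ Finset.range N, v n * e n) /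
    ∑ n ∈ Finset.range N, v n) atTop (𝓝 0) := by
  have h0 : Tendsto (fun N : ℕ => ∑ n ∈ Finset.range N, (e n : ℝ)) atTop atTop := by
    simpa using (tendsto_natCast_atTop_iff (R := ℝ)).2 h.tendsto_count
  have h1 : (fun n => v n * (e n : ℝ)) =o[atTop] fun n => (e n : ℝ) := by
    simpa using ((Asymptotics.isLittleO_one_iff ℝ).2 h.tendsto_zero).mul_isBigO
      (Asymptotics.isBigO_refl (fun n => (e n : ℝ)) atTop)
  have h2 := (h1.sum_range (fun n => Nat.cast_nonneg _) h0).tendsto_div_nhds_zero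
  have h3 := h2.mul h.tendsto_count_div
  rw [zero_mul] at h3
  refine h3.congr' ?_
  filter_upwards [h0.eventually_gt_atTop 0] with N hN
  push_cast
  field_simp

/-- The decrease of `v` contributes at most `v 0 * B` in total. The argument of `b` moves only when
`e n = 1`, which contributes at most `2 * B * ∑ v n * e n`. -/
theorem tendsto_variation {𝕜 : Type*} [RCLike 𝕜] {b : ℕ → 𝕜} {B : ℝ} (hB : ∀ n, ‖b n‖ ≤ B) :
    Tendsto (fun N : ℕ => (∑ n ∈ Finset.range N,
      ‖v (n + 1) • b (∑ k ∈ Finset.range (n + 1), e k) - v n • b (∑ k ∈ Finset.range n, e k)‖) /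
      ∑ n ∈ Finset.range N, v n) atTop (𝓝 0) := by
  have hB0 : 0 ≤ B := (norm_nonneg _).trans (hB 0)
  have h1 := ((tendsto_inv_smul_of_bounded h.tendsto_sum (b := fun _ => v 0 * B)
    fun _ => le_rfl)).add (h.tendsto_sum_mul_div.const_mul (2 * B))
  rw [mul_zero, add_zero] at h1
  refine squeeze_zero (fun N => div_nonneg (Finset.sum_nonneg fun _ _ => norm_nonneg _)
    (Finset.sum_nonneg fun n _ => h.nonneg n)) (fun N => ?_) h1
  have hstep : ∀ n, ‖v (n + 1) • b (∑ k ∈ Finset.range (n + 1), e k) -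
      v n • b (∑ k ∈ Finset.range n, e k)‖ ≤ (v n - v (n + 1)) * B + 2 * B * (v n * e n) := by
    intro n
    have e1 : v (n + 1) • b (∑ k ∈ Finset.range (n + 1), e k) -
        v n • b (∑ k ∈ Finset.range n, e k) =
        (v (n + 1) - v n) • b (∑ k ∈ Finset.range (n + 1), e k) +
        v n • (b (∑ k ∈ Finset.range (n + 1), e k) - b (∑ k ∈ Finset.range n, e k)) := by
      rw [sub_smul, smul_sub]; abel
    rw [e1]
    refine (norm_add_le _ _).trans (add_le_add ?_ ?_)
    · rw [norm_smul, Real.norm_eq_abs, abs_sub_comm,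
        abs_of_nonneg (sub_nonneg.2 (h.antitone n.le_succ))]
      exact mul_le_mul_of_nonneg_left (hB _) (sub_nonneg.2 (h.antitone n.le_succ))
    · rw [norm_smul, Real.norm_of_nonneg (h.nonneg n), Finset.sum_range_succ]
      rcases h.zero_or_one n with h0 | h0
      · simp [h0]
      · rw [h0, Nat.cast_one, mul_one, mul_comm (2 * B)]
        refine mul_le_mul_of_nonneg_left ((norm_sub_le _ _).trans ?_) (h.nonneg n)
        linarith [hB (∑ k ∈ Finset.range n, e k + 1), hB (∑ k ∈ Finset.range n, e k)]
  rw [smul_eq_mul, inv_mul_eq_div, ← mul_div_assoc, ← add_div]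
  refine div_le_div_of_nonneg_right ((Finset.sum_le_sum fun n _ => hstep n).trans ?_)
    (Finset.sum_nonneg fun n _ => h.nonneg n)
  rw [Finset.sum_add_distrib, ← Finset.sum_mul, ← Finset.mul_sum, Finset.sum_range_sub']
  have := mul_nonneg (h.nonneg N) hB0
  linarith

omit h in
-- At the selected times the running count takes each value exactly once, in order.
theorem sum_selected {E : Type*} [AddCommGroup E] [Module ℝ E]
    (h01 : ∀ n, e n = 0 ∨ e n = 1) (b : ℕ → E) (N : ℕ) :
    ∑ n ∈ Finset.range N, (e n : ℝ) • b (∑ k ∈ Finset.range n, e k) =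
      ∑ k ∈ Finset.range (∑ n ∈ Finset.range N, e n), b k := by
  induction N with
  | zero => simp
  | succ N ih =>
    rw [Finset.sum_range_succ, ih, Finset.sum_range_succ e]
    rcases h01 N with h | h <;> simp [h, Finset.sum_range_succ]

/-! ### Almost everywhere convergence for a fixed good selection. -/

section System

variable {X : Type*} [MeasurableSpace X] {μ : Measure X} [IsProbabilityMeasure μ] {T : X → X}
  {𝕜 : Type*} [RCLike 𝕜]

/-- Centered averages along the selections vanish almost everywhere. -/
theorem ae_tendsto_centered (hT : MeasurePreserving T μ μ) {F : X → 𝕜} (hFm : Measurable F)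
    {B : ℝ} (hB : ∀ x, ‖F x‖ ≤ B) :
    ∀ᵐ x ∂μ, Tendsto (fun N : ℕ => (∑ n ∈ Finset.range N, v n)⁻¹ •
      ∑ n ∈ Finset.range N, ((e n : ℝ) - v n) • F (T^[∑ k ∈ Finset.range n, e k] x))
      atTop (𝓝 0) := by
  obtain ⟨r, hr, hr', hrW, hE⟩ := h.exists_subseq
  set W : ℕ → ℝ := fun N => ∑ n ∈ Finset.range N, v n with hW
  have hpos : ∀ i, 0 < W (r i) := fun i => lt_of_lt_of_le (by positivity) (hrW i).1
  have hratio : Tendsto (fun i => W (r (i + 1)) / W (r i)) atTop (𝓝 1) :=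
    tendsto_ratio_of_quartic (W := fun i => W (r i))
      (fun i => h.monotone_sum (hr i.le_succ)) (fun i => (hrW i).1) (fun i => (hrW i).2)
  let D : ℕ → X → 𝕜 := fun N x =>
    ∑ n ∈ Finset.range N, ((e n : ℝ) - v n) • F (T^[∑ k ∈ Finset.range n, e k] x)
  have hDm : ∀ N, Measurable (D N) := fun N => Finset.measurable_sum _ fun n _ =>
    (hFm.comp (hT.measurable.iterate _)).const_smul _
  have hDi : ∀ N, Integrable (fun x => ‖D N x‖ ^ 2) μ := fun N => by
    refine Integrable.of_bound ((hDm N).norm.pow_const 2).aestronglyMeasurable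
      ((∑ n ∈ Finset.range N, ‖(e n : ℝ) - v n‖ * B) ^ 2) (Eventually.of_forall fun x => ?_)
    rw [norm_pow, norm_norm]
    gcongr
    refine norm_sum_le_of_le _ fun n _ => ?_
    rw [norm_smul]
    exact mul_le_mul_of_nonneg_left (hB _) (norm_nonneg _)
  -- The subsequence and the summable bound come from the selection alone; the system enters only
  -- through `B ^ 2`.
  have hsm : ∀ᵐ x ∂μ, Summable fun i => ‖D (r i) x‖ ^ 2 / W (r i) ^ 2 := by
    refine ae_summable_of_summable_integral (fun i => (hDi _).div_const _)
      (fun i x => by positivity) (hE.mul_left (B ^ 2)) fun i => ?_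
    rw [integral_div, ← mul_div_assoc]
    exact div_le_div_of_nonneg_right (integral_norm_sum_sq_le_lagEnergy hT hFm hB
      (monotone_count e) h.count_le (fun n => (e n : ℝ) - v n) (r i)) (sq_nonneg _)
  have hHr : Tendsto (fun i => (B * ∑ n ∈ Finset.range (r i), ((e n : ℝ) + v n)) / W (r i))
      atTop (𝓝 (B * (1 + 1))) := by
    refine (((h.tendsto_count_div.comp hr').add_const 1).const_mul B).congr fun i => ?_
    have := (hpos i).ne'
    simp only [Finset.sum_add_distrib, Function.comp_apply]
    push_cast
    change B * (_ / W (r i) + 1) = B * (_ + W (r i)) / W (r i)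
    field_simp
  filter_upwards [hsm] with x hx
  refine tendsto_inv_smul_of_subseq
    (h.norm_sum_centered_sub_le (fun n => hB (T^[∑ k ∈ Finset.range n, e k] x)))
    h.monotone_sum hr hr' hpos hratio (tendsto_zero_of_norm_sq ?_) hHr
  refine hx.tendsto_atTop_zero.congr fun i => ?_
  rw [norm_smul, mul_pow, norm_inv, Real.norm_of_nonneg (hpos i).le, inv_pow, inv_mul_eq_div]

/-- Averages of a single function along the slow random clock. -/
theorem ae_tendsto_single (hT : MeasurePreserving T μ μ) {F : X → 𝕜} (hFm : Measurable F)
    {B : ℝ} (hB : ∀ x, ‖F x‖ ≤ B) (hF : MemLp F 2 μ) :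
    ∀ᵐ x ∂μ, Tendsto (fun N : ℕ => (∑ n ∈ Finset.range N, v n)⁻¹ •
      ∑ n ∈ Finset.range N, v n • F (T^[∑ k ∈ Finset.range n, e k] x))
      atTop (𝓝 (invariantProj hT hF x)) := by
  filter_upwards [h.ae_tendsto_centered hT hFm hB, ae_tendsto_birkhoff hT hFm hB hF] with x h1 h2
  -- The Birkhoff average at time `s N`, rescaled by `s N / W N → 1`, is the `e`-weighted average;
  -- subtracting the centered one leaves the `v`-weighted one.
  have h3 := (h.tendsto_count_div.smul (h2.comp h.tendsto_count)).sub h1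
  rw [one_smul, sub_zero] at h3
  refine h3.congr' ?_
  filter_upwards [h.tendsto_count.eventually_gt_atTop 0] with N hN
  have hN' : ((∑ n ∈ Finset.range N, e n : ℕ) : ℝ) ≠ 0 := Nat.cast_ne_zero.2 hN.ne'
  simp only [Function.comp_apply, sub_smul, Finset.sum_sub_distrib]
  rw [sum_selected h.zero_or_one (fun k => F (T^[k] x)), smul_smul, div_mul_eq_mul_div,
    mul_inv_cancel₀ hN', one_div, smul_sub, sub_sub_cancel]

/-- The factor with `F₁` is treated as a slowly varying weight for `F₂`; once `F₂` is replaced by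
its projection, constant along the orbit, only the average of `F₁` is left. -/
theorem ae_tendsto_pair (hT : MeasurePreserving T μ μ) {F₁ F₂ : X → 𝕜} (hFm₁ : Measurable F₁)
    (hFm₂ : Measurable F₂) {B₁ B₂ : ℝ} (hB₁ : ∀ x, ‖F₁ x‖ ≤ B₁) (hB₂ : ∀ x, ‖F₂ x‖ ≤ B₂)
    (hF₁ : MemLp F₁ 2 μ) (hF₂ : MemLp F₂ 2 μ) :
    ∀ᵐ x ∂μ, Tendsto (fun N : ℕ => (∑ n ∈ Finset.range N, v n)⁻¹ •
      ∑ n ∈ Finset.range N, v n • (F₁ (T^[∑ k ∈ Finset.range n, e k] x) * F₂ (T^[n] x)))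
      atTop (𝓝 (invariantProj hT hF₁ x * invariantProj hT hF₂ x)) := by
  have hne : Nonempty X := nonempty_of_isProbabilityMeasure μ
  have hB₁0 : 0 ≤ B₁ := (norm_nonneg _).trans (hB₁ hne.some)
  have h2 := ae_tendsto_weighted_sub_invariantProj hT hFm₂ hB₂ hF₂ h.antitone h.nonneg
    h.tendsto_sum (w := fun x n => v n • F₁ (T^[∑ k ∈ Finset.range n, e k] x)) hB₁0
    (fun x n => by
      rw [norm_smul, Real.norm_of_nonneg (h.nonneg n), mul_comm]
      exact mul_le_mul_of_nonneg_right (hB₁ _) (h.nonneg n))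
    (fun x => h.tendsto_variation (b := fun k => F₁ (T^[k] x)) fun k => hB₁ _)
  filter_upwards [h2, h.ae_tendsto_single hT hFm₁ hB₁ hF₁] with x h2 h1
  have h3 := h2.add (h1.mul_const (invariantProj hT hF₂ x))
  rw [zero_add] at h3
  refine h3.congr fun N => ?_
  simp only [mul_sub, Finset.sum_sub_distrib, Finset.sum_mul, smul_mul_assoc, smul_sub,
    sub_add_cancel]

end System

end GoodSelection

end Sequences

/-! ### From random selections to the theorem. -/

/-- Almost every realisation of a random selection is good. -/
theorem IsRandomSelection.ae_goodSelection {Ω : Type*} [MeasurableSpace Ω] {P : Measure Ω}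
    [IsProbabilityMeasure P] {u : ℕ → ℝ} {U : ℕ → Ω → ℕ} (hU : IsRandomSelection P u U)
    (hmono : Antitone fun n => u (n + 1))
    (hsum : Tendsto (fun N : ℕ => ∑ n ∈ Finset.range N, u n) atTop atTop)
    (hlim : Tendsto u atTop (𝓝 0)) :
    ∀ᵐ ω ∂P, GoodSelection (fun n => u (n + 1)) fun n => U (n + 1) ω := by
  have hp : ∀ n, P.real {ω | U (n + 1) ω = 1} = u (n + 1) := fun n =>
    hU.prob_one _ (Nat.le_add_left 1 n)
  have h0 : ∀ n, 0 ≤ u (n + 1) := fun n => hp n ▸ measureReal_nonneg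
  have hS := tendsto_sum_shift hmono h0 hsum
  have h01 : ∀ n ω, U (n + 1) ω = 0 ∨ U (n + 1) ω = 1 := fun n =>
    hU.zero_or_one _ (Nat.le_add_left 1 n)
  have hind : iIndepFun (fun n => U (n + 1)) P :=
    hU.indep.precomp (g := fun n : ℕ => (⟨n + 1, Nat.le_add_left 1 n⟩ : {n : ℕ // 1 ≤ n}))
      fun m n hmn => Nat.succ_injective (congrArg Subtype.val hmn)
  obtain ⟨r, hr, hr', hrW⟩ := exists_subseq_quartic
    (fun n => hp n ▸ measureReal_le_one) hS
  filter_upwards [ae_summable_lagEnergy (fun n => hU.measurable _ (Nat.le_add_left 1 n)) h01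
    hind hp (fun i => (hrW i).1) fun i => (hrW i).2] with ω hω
  exact ⟨hmono, h0, hlim.comp (tendsto_add_atTop_nat 1), hS, fun n => h01 n ω, r, hr, hr', hrW, hω⟩

theorem mainTheorem5 (𝕜 : Type*) [RCLike 𝕜]
    {Ω : Type*} [MeasurableSpace Ω] (P : Measure Ω) [IsProbabilityMeasure P]
    (u : ℕ → ℝ) (U : ℕ → Ω → ℕ) (hU : IsRandomSelection P u U)
    (hmono : AntitoneOn u (Set.Ici 1))
    (hsum : Tendsto (fun N : ℕ => ∑ n ∈ Finset.range N, u n) atTop atTop)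
    (hlim : Tendsto u atTop (𝓝 0)) :
    ∀ᵐ ω ∂P, ∀ (X : Type*) [MeasurableSpace X] (μ : Measure X) [IsProbabilityMeasure μ]
      (T : X → X) (hT : MeasurePreserving T μ μ) (F₁ F₂ : X → 𝕜)
      (hF₁ : Measurable F₁) (hb₁ : ∃ C : ℝ, ∀ x, ‖F₁ x‖ ≤ C)
      (hF₂ : Measurable F₂) (hb₂ : ∃ C : ℝ, ∀ x, ‖F₂ x‖ ≤ C),
      ∀ᵐ x ∂μ, Tendsto
        (fun N : ℕ => (∑ n ∈ Finset.range N, u n)⁻¹ •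
          ∑ n ∈ Finset.range N,
            u n • (F₁ (T^[∑ k ∈ Finset.Icc 1 n, U k ω] x) * F₂ (T^[n] x)))
        atTop
        (𝓝 (invariantProj hT (memLp_two_of_bounded (μ := μ) hF₁ hb₁) x *
          invariantProj hT (memLp_two_of_bounded (μ := μ) hF₂ hb₂) x)) := by
  have hmono' : Antitone fun n => u (n + 1) := fun m n hmn =>
    hmono (Nat.le_add_left 1 m) (Nat.le_add_left 1 n) (Nat.succ_le_succ hmn)
  filter_upwards [hU.ae_goodSelection hmono' hsum hlim] with ω hω
  intro X _ μ _ T hT F₁ F₂ hF₁ hb₁ hF₂ hb₂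
  have h₁ := memLp_two_of_bounded (μ := μ) hF₁ hb₁
  have h₂ := memLp_two_of_bounded (μ := μ) hF₂ hb₂
  obtain ⟨B₁, hB₁⟩ := hb₁
  obtain ⟨B₂, hB₂⟩ := hb₂
  filter_upwards [hω.ae_tendsto_pair hT hF₁ hF₂ hB₁ hB₂ h₁ h₂] with x hx
  have hs : ∀ n, ∑ k ∈ Finset.Icc 1 n, U k ω = ∑ k ∈ Finset.range n, U (k + 1) ω := fun n => by
    rw [Finset.range_eq_Ico, Finset.sum_Ico_add' (fun k => U k ω) 0 n 1]
    rfl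
  simp only [hs]
  -- The exponent `U 1 + ... + U n` was paired with the weight `u (n + 1)`, the probability of the
  -- first variable outside it; the shift restores `u n`, and with it the arbitrary `u 0`.
  refine tendsto_inv_smul_sum_of_shift hmono' hω.nonneg hsum (B := B₁ * B₂) (fun n => ?_) hx
  rw [norm_mul]
  exact mul_le_mul (hB₁ _) (hB₂ _) (norm_nonneg _) ((norm_nonneg _).trans (hB₁ x))
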